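/- Fix $n$. Let $\|\cdot\|$ and $\cdot$ denote the Euclidean norm and scalar product on $\mathbb{R}^n$, and $\|u\|_\infty:=\max_{x\in[0,1]}\|u(x)\|$. Let $a,f:[0,1]\times\mathbb{R}\times\mathbb{R}^n\times\mathbb{R}^n\to\mathbb{R}^n$, written $a(x,y,u,u')$ and $f(x,y,u,u')$, be 1-periodic in $y$ and such that $a,\partial_ua,\partial_{u'}a,f,\partial_uf,\partial_{u'}f$ exist and are continuous on $[0,1]\times\mathbb{R}\times\mathbb{R}^n\times\mathbb{R}^n$. Suppose that there are constants $M\ge m>0$ such that for all $x\in[0,1]$, $y\in\mathbb{R}$ and $u,u_1',u_2'\in\mathbb{R}^n$ with $\|u\|\le1$ $$\big(a(x,y,u,u_1')-a(x,y,u,u_2')\big)\cdot(u_1'-u_2')\ge m\|u_1'-u_2'\|^2,\qquad \|a(x,y,u,u_1')-a(x,y,u,u_2')\|\le M\|u_1'-u_2'\|.$$ For $x\in[0,1]$, $y\in\mathbb{R}$ and $\|u\|\le1$ put $b(x,y,u,\cdot):=a(x,y,u,\cdot)^{-1}$, $b_0(x,u,\cdot):=\int_0^1b(x,y,u,\cdot)\,dy$,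 $a_0(x,u,\cdot):=b_0(x,u,\cdot)^{-1}$ (all these inverses $\mathbb{R}^n\to\mathbb{R}^n$ exist) and $$f_0(x,u,u'):=\int_0^1f\big(x,y,u,b(x,y,u,a_0(x,u,u'))\big)\,dy .$$ A weak solution of a boundary value problem $A(x,u(x),u'(x))'=F(x,u(x),u'(x))$ for $x\in[0,1]$, $u(0)=A(1,u(1),u'(1))=0$, is a function $u\in C^1([0,1];\mathbb{R}^n)$ with $u(0)=0$ and $$\int_0^1\big(A(x,u(x),u'(x))\cdot\varphi'(x)+F(x,u(x),u'(x))\cdot\varphi(x)\big)\,dx=0\quad\text{for all }\varphi\in C^1([0,1];\mathbb{R}^n)\text{ with }\varphi(0)=0.$$ Let $u_0$ be a weak solution of the homogenized problem $$a_0(x,u(x),u'(x))'=f_0(x,u(x),u'(x)),\qquad u(0)=a_0(1,u(1),u'(1))=0,$$ with $\|u_0\|_\infty<1$, and suppose that the linearized problem $$\big(A_1(x)u(x)+A_2(x)u'(x)\big)'=F_1(x)u(x)+F_2(x)u'(x),\qquad u(0)=A_1(1)u(1)+A_2(1)u'(1)=0,$$ where $A_1,A_2,F_1,F_2$ are $\partial_ua_0,\partial_{u'}a_0,\partial_uf_0,\partial_{u'}f_0$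 evaluated at $(x,u_0(x),u_0'(x))$, has no weak solution $u\neq0$. Then: (i) There exist $\varepsilon_0>0$ and $\delta>0$ such that for all $\varepsilon\in(0,\varepsilon_0]$ there is exactly one weak solution $u=u_\varepsilon$ of $$a(x,x/\varepsilon,u(x),u'(x))'=f(x,x/\varepsilon,u(x),u'(x)),\qquad u(0)=a(1,1/\varepsilon,u(1),u'(1))=0,$$ with $\|u-u_0\|_\infty\le\delta$. Moreover, $\|u_\varepsilon-u_0\|_\infty\to0$ for $\varepsilon\to0$. (ii) If in addition $\partial_xa$ and $\partial_xf$ exist and are continuous on $[0,1]\times\mathbb{R}\times\mathbb{R}^n\times\mathbb{R}^n$, then $\|u_\varepsilon-u_0\|_\infty=O(\varepsilon)$ for $\varepsilon\to0$. -/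

import Mathlib

open Set Filter Topology

/-- The space of vectors `v ∈ ℝⁿ` with the Euclidean norm and scalar product. -/
abbrev Vec (n : ℕ) : Type := EuclideanSpace ℝ (Fin n)

/-- The maximum norm over `[0,1]` (of functions that are continuous on `[0,1]`). -/
noncomputable def supNorm {n : ℕ} (u : ℝ → Vec n) : ℝ :=
  sSup ((fun x => ‖u x‖) '' Icc (0 : ℝ) 1)

/-- The derivative of a function on `[0,1]`, one-sided at the end points. -/
noncomputable def deriv01 {n : ℕ} (u : ℝ → Vec n) (x : ℝ) : Vec n :=
  derivWithin u (Icc (0 : ℝ) 1) x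

/-- `u` is a weak solution of `A(x,u(x),u'(x))' = F(x,u(x),u'(x))` on `[0,1]` with the boundary
conditions `u(0) = 0` and `A(1,u(1),u'(1)) = 0`: it is of class `C¹` on `[0,1]`, vanishes at `0`,
and satisfies the variational equation. The natural boundary condition at `1` is encoded in the
freedom of the test functions at `1`. -/
def IsWeakSolution {n : ℕ} (A F : ℝ → Vec n → Vec n → Vec n) (u : ℝ → Vec n) : Prop :=
  ContDiffOn ℝ 1 u (Icc (0 : ℝ) 1) ∧ u 0 = 0 ∧
    ∀ φ : ℝ → Vec n, ContDiffOn ℝ 1 φ (Icc (0 : ℝ) 1) → φ 0 = 0 →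
      ∫ x in (0 : ℝ)..1,
        (inner ℝ (A x (u x) (deriv01 u x)) (deriv01 φ x)
          + inner ℝ (F x (u x) (deriv01 u x)) (φ x)) = 0

/-- Weak solutions of `a(x,x/ε,u,u')' = f(x,x/ε,u,u')`, `u(0) = a(1,1/ε,u(1),u'(1)) = 0`. -/
def IsWeakSolutionEps {n : ℕ} (a f : ℝ → ℝ → Vec n → Vec n → Vec n) (ε : ℝ)
    (u : ℝ → Vec n) : Prop :=
  IsWeakSolution (fun x v p => a x (x / ε) v p) (fun x v p => f x (x / ε) v p) u

/-- `b(x,y,u,·)`, the inverse of the map `a(x,y,u,·)`. -/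
noncomputable def fluxInv {n : ℕ} (a : ℝ → ℝ → Vec n → Vec n → Vec n)
    (x y : ℝ) (u : Vec n) : Vec n → Vec n :=
  Function.invFun (a x y u)

/-- `b₀(x,u,q) = ∫₀¹ b(x,y,u,q) dy`. -/
noncomputable def homFluxInv {n : ℕ} (a : ℝ → ℝ → Vec n → Vec n → Vec n)
    (x : ℝ) (u q : Vec n) : Vec n :=
  ∫ y in (0 : ℝ)..1, fluxInv a x y u q

/-- The homogenized flux: `a₀(x,u,·)` is the inverse of the map `b₀(x,u,·)`. -/
noncomputable def homFlux {n : ℕ} (a : ℝ → ℝ → Vec n → Vec n → Vec n)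
    (x : ℝ) (u : Vec n) : Vec n → Vec n :=
  Function.invFun (homFluxInv a x u)

/-- The homogenized reaction `f₀(x,u,p) = ∫₀¹ f(x,y,u,b(x,y,u,a₀(x,u,p))) dy`, i.e.
`f₀(x,u,b₀(x,u,q)) = ∫₀¹ f(x,y,u,b(x,y,u,q)) dy`. -/
noncomputable def homReaction {n : ℕ} (a f : ℝ → ℝ → Vec n → Vec n → Vec n)
    (x : ℝ) (u p : Vec n) : Vec n :=
  ∫ y in (0 : ℝ)..1, f x y u (fluxInv a x y u (homFlux a x u p))

/-- The linearization `(x,v,p) ↦ ∂_u G(x,u(x),u'(x)) v + ∂_{u'} G(x,u(x),u'(x)) p` of the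
nonlinearity `G` along the function `u`. -/
noncomputable def linearize {n : ℕ} (G : ℝ → Vec n → Vec n → Vec n) (u : ℝ → Vec n)
    (x : ℝ) (v p : Vec n) : Vec n :=
  fderiv ℝ (fun w => G x w (deriv01 u x)) (u x) v + fderiv ℝ (fun q => G x (u x) q) (deriv01 u x) p

/-- `g(x,y,u,u')` is 1-periodic with respect to `y`. -/
def PeriodicY {n : ℕ} (g : ℝ → ℝ → Vec n → Vec n → Vec n) : Prop :=
  ∀ x ∈ Icc (0 : ℝ) 1, ∀ (y : ℝ) (u p : Vec n), g x (y + 1) u p = g x y u p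

/-- Joint continuity of `h(x,y,u,u')` on `[0,1] × ℝ × ℝⁿ × ℝⁿ`. -/
def JointlyContinuous {n : ℕ} {X : Type} [TopologicalSpace X]
    (h : ℝ → ℝ → Vec n → Vec n → X) : Prop :=
  ContinuousOn (fun z : ℝ × ℝ × Vec n × Vec n => h z.1 z.2.1 z.2.2.1 z.2.2.2)
    (Icc (0 : ℝ) 1 ×ˢ univ)

/-- `g`, `∂_u g` and `∂_{u'} g` exist and are continuous on `[0,1] × ℝ × ℝⁿ × ℝⁿ`. -/
def RegularInU {n : ℕ} (g : ℝ → ℝ → Vec n → Vec n → Vec n) : Prop :=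
  JointlyContinuous g ∧
  (∀ x ∈ Icc (0 : ℝ) 1, ∀ (y : ℝ) (u p : Vec n),
    DifferentiableAt ℝ (fun w => g x y w p) u ∧ DifferentiableAt ℝ (fun q => g x y u q) p) ∧
  JointlyContinuous (fun x y u p => fderiv ℝ (fun w => g x y w p) u) ∧
  JointlyContinuous (fun x y u p => fderiv ℝ (fun q => g x y u q) p)

/-- `∂_x g` exists (one-sided at the end points) and is continuous on `[0,1] × ℝ × ℝⁿ × ℝⁿ`. -/
def RegularInX {n : ℕ} (g : ℝ → ℝ → Vec n → Vec n → Vec n) : Prop :=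
  (∀ x ∈ Icc (0 : ℝ) 1, ∀ (y : ℝ) (u p : Vec n),
    DifferentiableWithinAt ℝ (fun s => g s y u p) (Icc (0 : ℝ) 1) x) ∧
  JointlyContinuous (fun x y u p => deriv01 (fun s => g s y u p) x)

/-- `a(x,y,u,·)` is strongly monotone with constant `m` and Lipschitz continuous with constant `M`,
uniformly with respect to `x ∈ [0,1]`, `y ∈ ℝ` and `‖u‖ ≤ 1`. -/
def StronglyMonotoneLipschitz {n : ℕ} (a : ℝ → ℝ → Vec n → Vec n → Vec n) (m M : ℝ) : Prop :=
  ∀ x ∈ Icc (0 : ℝ) 1, ∀ (y : ℝ) (u p q : Vec n), ‖u‖ ≤ 1 →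
    m * ‖p - q‖ ^ 2 ≤ inner ℝ (a x y u p - a x y u q) (p - q) ∧
    ‖a x y u p - a x y u q‖ ≤ M * ‖p - q‖

/-! Take the flux `q = a(x, x/ε, u, u')` as a second unknown. By strong monotonicity the problem
becomes a first order system `z' = G(x, x/ε, z)` for `z = (u, q)` with `u(0) = 0`, `q(1) = 0`, where
`G` is `redField`, built from `b` and `f`. Since `b₀` and the reaction are cell means at fixed `u`
and `q`, the homogenized problem is exactly the averaged system `z' = ∫₀¹ G(x, y, z) dy`
(`isFirstOrderForm_averaged`). Integration turns the two systems into fixed point equations `z = T_ε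
z` (`oscillatingMap`) and `z = T₀ z` (`averagedMap`) for continuous functions on `[0,1]`. The maps
`proj01` and `clampBall` only make `G` globally defined; they are inactive on the solutions
considered.

At the averaged solution `z₀`, `norm_integral_oscillating_sub_mean_le` gives `T_ε z₀ → T₀ z₀ = z₀`,
with rate `ε` if the integrand is Lipschitz in `x`. The linearizations `L_ε` at `z₀` converge to the
compact operator `L₀` uniformly on functions with bounded norm and Lipschitz constant, but in
general not in operator norm. However, `L_ε` maps bounded functions to Lipschitz ones, so `(L_ε -
L₀) L_ε → 0` in norm, and `P = 1 + (1 - L₀)⁻¹ L_ε` is an approximate left inverse of `1 - L_ε`. The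
inverse of `1 - L₀` exists by the Fredholm alternative and nondegeneracy
(`eq_zero_of_bvpLinear_eq`). The modified Newton iteration with `P` contracts near `z₀`
(`exists_fixedPoint_of_approximate_inverse`); this gives existence, local uniqueness and an error
bound by a multiple of `‖T_ε z₀ - z₀‖`.

That uniqueness concerns pairs `(u, q)` near `z₀`, whereas only `u` is assumed to be close to `u₀`.
`exists_flux_close` bridges the gap: a flux deviation of size `r` would persist over an interval of
fixed length and, by strong monotonicity of the averaged inverse flux, drive `u` away from `u₀`. -/

/-! ### Strongly monotone maps and their inverses -/

section Monotone

variable {E : Type*} [NormedAddCommGroup E] [InnerProductSpace ℝ E]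

/-- Strong monotonicity with constant `m`. -/
def StronglyMonotone (m : ℝ) (F : E → E) : Prop :=
  ∀ p q, m * ‖p - q‖ ^ 2 ≤ inner ℝ (F p - F q) (p - q)

theorem StronglyMonotone.antilipschitz {m : ℝ} {F : E → E} (hF : StronglyMonotone m F) (p q : E) :
    m * ‖p - q‖ ≤ ‖F p - F q‖ := by
  rcases eq_or_ne p q with rfl | hne
  · simp
  have hpos : 0 < ‖p - q‖ := norm_pos_iff.2 (sub_ne_zero.2 hne)
  refine le_of_mul_le_mul_right ?_ hpos
  calc m * ‖p - q‖ * ‖p - q‖ = m * ‖p - q‖ ^ 2 := by ring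
    _ ≤ inner ℝ (F p - F q) (p - q) := hF p q
    _ ≤ ‖F p - F q‖ * ‖p - q‖ := real_inner_le_norm _ _

theorem StronglyMonotone.injective {m : ℝ} (hm : 0 < m) {F : E → E} (hF : StronglyMonotone m F) :
    Function.Injective F := by
  intro p q h
  have := hF.antilipschitz p q
  rw [h, sub_self, norm_zero] at this
  have h0 : ‖p - q‖ ≤ 0 := by
    by_contra hc
    push Not at hc
    nlinarith
  exact sub_eq_zero.1 (norm_le_zero_iff.1 h0)

/-- Banach's fixed point theorem for `p ↦ p - τ • (F p - y)`. Expanding the square bounds the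
squared Lipschitz constant by `1 - 2τm + τ²M²`, which is smallest, namely `1 - m²/M²`, at `τ = m /
M²`. -/
theorem StronglyMonotone.surjective [CompleteSpace E] {m M : ℝ} (hm : 0 < m) (hmM : m ≤ M)
    {F : E → E} (hF : StronglyMonotone m F) (hL : ∀ p q, ‖F p - F q‖ ≤ M * ‖p - q‖) :
    Function.Surjective F := by
  intro y
  have hM : 0 < M := hm.trans_le hmM
  set τ : ℝ := m / M ^ 2 with hτ
  have hτ0 : 0 < τ := by positivity
  set N : E → E := fun p => p - τ • (F p - y) with hN
  set k : ℝ := Real.sqrt (1 - m ^ 2 / M ^ 2) with hk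
  have hle : m ^ 2 / M ^ 2 ≤ 1 := by
    rw [div_le_one (by positivity)]; gcongr
  have hk1 : k < 1 := by
    rw [hk, Real.sqrt_lt' one_pos]
    have : 0 < m ^ 2 / M ^ 2 := by positivity
    linarith
  have hdist : ∀ p q, ‖N p - N q‖ ≤ k * ‖p - q‖ := by
    intro p q
    have e : N p - N q = (p - q) - τ • (F p - F q) := by
      simp only [hN, smul_sub]; abel
    refine le_of_sq_le_sq ?_ (by positivity)
    rw [e, norm_sub_sq_real, mul_pow, hk, Real.sq_sqrt (by linarith), inner_smul_right,
      real_inner_comm, norm_smul, mul_pow, Real.norm_eq_abs, sq_abs]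
    have h1 := hF p q
    have h2 : ‖F p - F q‖ ^ 2 ≤ M ^ 2 * ‖p - q‖ ^ 2 := by
      rw [← mul_pow]; gcongr; exact hL p q
    have e2 : τ * m = m ^ 2 / M ^ 2 := by rw [hτ]; ring
    have e3 : τ ^ 2 * M ^ 2 = m ^ 2 / M ^ 2 := by rw [hτ]; field_simp
    have h3 : τ * (m * ‖p - q‖ ^ 2) ≤ τ * inner ℝ (F p - F q) (p - q) := by gcongr
    have h4 : τ ^ 2 * ‖F p - F q‖ ^ 2 ≤ τ ^ 2 * (M ^ 2 * ‖p - q‖ ^ 2) := by gcongr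
    rw [← mul_assoc, e2] at h3
    rw [← mul_assoc, e3] at h4
    linarith
  have hc : ContractingWith ⟨k, Real.sqrt_nonneg _⟩ N := by
    refine ⟨by exact_mod_cast hk1, LipschitzWith.of_dist_le_mul fun p q => ?_⟩
    rw [dist_eq_norm, dist_eq_norm]
    exact hdist p q
  refine ⟨ContractingWith.fixedPoint N hc, ?_⟩
  have h := hc.fixedPoint_isFixedPt
  set x := ContractingWith.fixedPoint N hc
  have h' : x - τ • (F x - y) = x := h
  have h'' : τ • (F x - y) = 0 := by simpa using h'
  exact sub_eq_zero.1 ((smul_eq_zero.1 h'').resolve_left hτ0.ne')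

theorem StronglyMonotone.apply_invFun [CompleteSpace E] {m M : ℝ} (hm : 0 < m) (hmM : m ≤ M)
    {F : E → E} (hF : StronglyMonotone m F) (hL : ∀ p q, ‖F p - F q‖ ≤ M * ‖p - q‖) (q : E) :
    F (Function.invFun F q) = q :=
  Function.invFun_eq (hF.surjective hm hmM hL q)

/-- Monotonicity of `F` is read at the preimages; the upper Lipschitz bound turns the distance of
the preimages into that of the images, at the cost of the factor `M ^ 2`. -/
theorem StronglyMonotone.invFun [CompleteSpace E] {m M : ℝ} (hm : 0 < m) (hmM : m ≤ M)
    {F : E → E} (hF : StronglyMonotone m F) (hL : ∀ p q, ‖F p - F q‖ ≤ M * ‖p - q‖) :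
    StronglyMonotone (m / M ^ 2) (Function.invFun F) := by
  intro p q
  have hM : 0 < M := hm.trans_le hmM
  have h1 := hF (Function.invFun F p) (Function.invFun F q)
  have h2 := hL (Function.invFun F p) (Function.invFun F q)
  rw [hF.apply_invFun hm hmM hL, hF.apply_invFun hm hmM hL] at h1 h2
  rw [real_inner_comm]
  refine le_trans ?_ h1
  have : ‖p - q‖ ^ 2 ≤ M ^ 2 * ‖Function.invFun F p - Function.invFun F q‖ ^ 2 := by
    rw [← mul_pow]; gcongr
  rw [div_mul_eq_mul_div, div_le_iff₀ (by positivity)]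
  nlinarith

theorem StronglyMonotone.norm_invFun_sub_le [CompleteSpace E] {m M : ℝ} (hm : 0 < m) (hmM : m ≤ M)
    {F : E → E} (hF : StronglyMonotone m F) (hL : ∀ p q, ‖F p - F q‖ ≤ M * ‖p - q‖) (p q : E) :
    ‖Function.invFun F p - Function.invFun F q‖ ≤ m⁻¹ * ‖p - q‖ := by
  have h := hF.antilipschitz (Function.invFun F p) (Function.invFun F q)
  rw [hF.apply_invFun hm hmM hL, hF.apply_invFun hm hmM hL] at h
  rwa [inv_mul_eq_div, le_div_iff₀' hm]

/-- The inverses of a continuous family of strongly monotone maps form a continuous family. -/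
theorem continuous_invFun_of_stronglyMonotone [CompleteSpace E] {Λ : Type*} [TopologicalSpace Λ]
    {m M : ℝ} (hm : 0 < m) (hmM : m ≤ M) {F : Λ → E → E} (hF : ∀ l, StronglyMonotone m (F l))
    (hL : ∀ l p q, ‖F l p - F l q‖ ≤ M * ‖p - q‖) (hc : ∀ p, Continuous fun l => F l p) :
    Continuous fun z : Λ × E => Function.invFun (F z.1) z.2 := by
  rw [continuous_iff_continuousAt]
  rintro ⟨l, q⟩
  rw [ContinuousAt, tendsto_iff_norm_sub_tendsto_zero]
  set p := Function.invFun (F l) q with hp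
  have hpq : F l p = q := (hF l).apply_invFun hm hmM (hL l) q
  have hlim : Tendsto (fun z : Λ × E => m⁻¹ * ‖z.2 - F z.1 p‖) (𝓝 (l, q)) (𝓝 0) := by
    have : Continuous fun z : Λ × E => m⁻¹ * ‖z.2 - F z.1 p‖ :=
      continuous_const.mul ((continuous_snd.sub ((hc p).comp continuous_fst)).norm)
    simpa [hpq] using this.tendsto (l, q)
  refine squeeze_zero (fun _ => norm_nonneg _) (fun z => ?_) hlim
  -- Comparing with the fixed point `p` at the moving parameter `z.1` makes continuity in the
  -- parameter for each fixed argument sufficient.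
  have h := (hF z.1).antilipschitz (Function.invFun (F z.1) z.2) p
  rw [(hF z.1).apply_invFun hm hmM (hL z.1)] at h
  rwa [inv_mul_eq_div, le_div_iff₀' hm]

/-- Monotonicity between `p + t • v` and `p`, divided by `t ^ 2`, passes to the limit `t → 0+`. -/
theorem StronglyMonotone.coercive_of_hasFDerivAt {m : ℝ} {F : E → E} (hF : StronglyMonotone m F)
    {A : E →L[ℝ] E} {p : E} (hA : HasFDerivAt F A p) (v : E) :
    m * ‖v‖ ^ 2 ≤ inner ℝ (A v) v := by
  have h1 : HasDerivAt (fun t : ℝ => F (p + t • v)) (A v) 0 := hA.hasLineDerivAt v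
  have h2 := h1.tendsto_slope_zero_right
  have h3 : Tendsto (fun t : ℝ => inner ℝ (t⁻¹ • (F (p + (0 + t) • v) - F (p + (0 : ℝ) • v))) v)
      (𝓝[>] 0) (𝓝 (inner ℝ (A v) v)) := h2.inner tendsto_const_nhds
  refine ge_of_tendsto h3 ?_
  filter_upwards [self_mem_nhdsWithin] with t ht
  have ht : 0 < t := ht
  have h := hF (p + t • v) p
  simp only [add_sub_cancel_left, norm_smul, inner_smul_right, Real.norm_eq_abs,
    abs_of_pos ht] at h
  simp only [zero_add, zero_smul, add_zero, inner_smul_left, RCLike.conj_to_real]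
  rw [inv_mul_eq_div, le_div_iff₀ ht]
  nlinarith

theorem exists_continuousLinearEquiv_of_coercive [FiniteDimensional ℝ E] {m : ℝ} (hm : 0 < m)
    {A : E →L[ℝ] E} (hA : ∀ v, m * ‖v‖ ^ 2 ≤ inner ℝ (A v) v) :
    ∃ e : E ≃L[ℝ] E, (e : E →L[ℝ] E) = A := by
  have hinj : Function.Injective (A : E →ₗ[ℝ] E) := by
    rw [← LinearMap.ker_eq_bot, LinearMap.ker_eq_bot']
    intro v hv
    have h := hA v
    rw [show A v = 0 from hv, inner_zero_left] at h
    have : ‖v‖ ^ 2 ≤ 0 := by nlinarith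
    exact norm_eq_zero.1 (by nlinarith [norm_nonneg v])
  refine ⟨(LinearEquiv.ofInjectiveEndo (A : E →ₗ[ℝ] E) hinj).toContinuousLinearEquiv, ?_⟩
  ext v
  rfl

/-- The derivative of the parameter dependent inverse `S` of a family `F (u, ·)`. -/
theorem hasStrictFDerivAt_of_parametric_inverse {U : Type*} [NormedAddCommGroup U]
    [NormedSpace ℝ U] {F S : U × E → E} {F' : U × E →L[ℝ] E} {u : U} {q : E} {e : E ≃L[ℝ] E}
    (hS : ContinuousAt S (u, q)) (hF : HasStrictFDerivAt F F' (u, S (u, q)))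
    (hFS : ∀ w, F (w.1, S w) = w.2)
    (he : (e : E →L[ℝ] E) = F'.comp (ContinuousLinearMap.inr ℝ U E)) :
    HasStrictFDerivAt S ((e.symm : E →L[ℝ] E).comp (ContinuousLinearMap.snd ℝ U E -
      (F'.comp (ContinuousLinearMap.inl ℝ U E)).comp (ContinuousLinearMap.fst ℝ U E))) (u, q) := by
  set T : U × E →L[ℝ] E := (e.symm : E →L[ℝ] E).comp (ContinuousLinearMap.snd ℝ U E -
      (F'.comp (ContinuousLinearMap.inl ℝ U E)).comp (ContinuousLinearMap.fst ℝ U E)) with hT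
  have hsplit : ∀ v : U, ∀ p : E, F' (v, p) = F' (v, 0) + e p := by
    intro v p
    have : e p = F' (0, p) := by
      have := congrArg (fun B : E →L[ℝ] E => B p) he
      simpa using this
    rw [this, ← map_add]
    simp
  -- The derivative of `(u, p) ↦ (u, F (u, p))`, which has the right inverse `(u, q) ↦ (u, S (u,
  -- q))`. As `S` is already known to be continuous, the inverse function rule applies without
  -- constructing a local inverse.
  set Φ : (U × E) ≃L[ℝ] (U × E) := ContinuousLinearEquiv.equivOfInverse
    ((ContinuousLinearMap.fst ℝ U E).prod F') ((ContinuousLinearMap.fst ℝ U E).prod T)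
    (by
      rintro ⟨v, p⟩
      simp [hT, hsplit v p])
    (by
      rintro ⟨v, p⟩
      simp only [hT, ContinuousLinearMap.comp_apply, ContinuousLinearMap.prod_apply]
      simp [hsplit v (e.symm _ - _)]) with hΦ
  have hd : HasStrictFDerivAt (fun w : U × E => (w.1, F w)) (Φ : U × E →L[ℝ] U × E)
      ((fun w : U × E => (w.1, S w)) (u, q)) :=
    hasStrictFDerivAt_fst.prodMk hF
  have hg : ContinuousAt (fun w : U × E => (w.1, S w)) (u, q) := continuousAt_fst.prodMk hS
  have := hd.of_local_left_inverse hg (Eventually.of_forall fun w => by simp [hFS w])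
  exact this.snd

end Monotone

/-! ### Averaging of rapidly oscillating integrands -/

section Averaging

variable {X : Type*} [NormedAddCommGroup X] [NormedSpace ℝ X]

/-- The mean value of a function of one real variable over `[0,1]`. -/
noncomputable def cellMean (h : ℝ → X) : X := ∫ y in (0 : ℝ)..1, h y

theorem norm_cellMean_le {h : ℝ → X} {H : ℝ} (hH : ∀ y, ‖h y‖ ≤ H) : ‖cellMean h‖ ≤ H := by
  simpa [cellMean] using
    intervalIntegral.norm_integral_le_of_norm_le_const (a := (0 : ℝ)) (b := 1) (fun y _ => hH y)

theorem continuous_cellMean {Λ : Type*} [TopologicalSpace Λ]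
    {h : Λ → ℝ → X} (hh : Continuous (Function.uncurry h)) : Continuous fun l => cellMean (h l) :=
  intervalIntegral.continuous_parametric_intervalIntegral_of_continuous' hh 0 1

/-- Quantitative averaging of a rapidly oscillating integrand. -/
theorem norm_integral_oscillating_sub_mean_le [CompleteSpace X] {h : ℝ → ℝ → X}
    (hh : Continuous (Function.uncurry h)) (hper : ∀ s y, h s (y + 1) = h s y)
    {H ω ε : ℝ} (hε : 0 < ε) (hH : ∀ s y, ‖h s y‖ ≤ H)
    (hω : ∀ s s' y, |s - s'| ≤ ε → ‖h s y - h s' y‖ ≤ ω) {a b : ℝ} (hab : a ≤ b) :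
    ‖∫ s in a..b, (h s (s / ε) - cellMean (h s))‖ ≤ ω * (b - a) + 2 * H * ε := by
  have hH0 : 0 ≤ H := (norm_nonneg _).trans (hH 0 0)
  have c1 : Continuous fun s => h s (s / ε) :=
    hh.comp (continuous_id.prodMk (continuous_id.div_const ε))
  have c2 : Continuous fun s => cellMean (h s) := continuous_cellMean hh
  have cshift : Continuous fun z : ℝ × ℝ => h z.1 (z.1 / ε + z.2) :=
    hh.comp (continuous_fst.prodMk ((continuous_fst.div_const ε).add continuous_snd))
  -- By periodicity the mean may be taken over the period starting at the phase `s / ε`, so the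
  -- averaged integral becomes a mean over phase shifts `t` of oscillating integrals.
  have hmean : ∀ s, cellMean (h s) = ∫ t in (0 : ℝ)..1, h s (s / ε + t) := by
    intro s
    have hp : Function.Periodic (h s) 1 := hper s
    rw [intervalIntegral.integral_comp_add_left (fun t => h s t), cellMean, add_zero]
    simpa using hp.intervalIntegral_add_eq 0 (s / ε)
  have hswap : ∫ s in a..b, cellMean (h s) = ∫ t in (0 : ℝ)..1, ∫ s in a..b, h s (s / ε + t) := by
    simp_rw [hmean]
    refine MeasureTheory.intervalIntegral_intervalIntegral_swap ?_
    have : IsCompact (uIcc a b ×ˢ uIcc (0 : ℝ) 1) := isCompact_uIcc.prod isCompact_uIcc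
    exact (cshift.continuousOn.integrableOn_compact this).mono_set
      (prod_mono uIoc_subset_uIcc uIoc_subset_uIcc)
  set J : ℝ → X := fun t => ∫ s in a..b, h s (s / ε + t) with hJ
  have cJ : Continuous J := by
    refine intervalIntegral.continuous_parametric_intervalIntegral_of_continuous'
      (f := fun t s => h s (s / ε + t)) ?_ a b
    exact cshift.comp continuous_swap
  set I : X := ∫ s in a..b, h s (s / ε) with hI
  -- A phase shift by `t` is a translation of `s` by `ε * t`, up to an error `ω` from the slow
  -- variable. The translation changes the integral only by two end pieces of length at most `ε`.
  have key : ∀ t ∈ Icc (0 : ℝ) 1, ‖I - J t‖ ≤ ω * (b - a) + 2 * H * ε := by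
    intro t ht
    have cs : Continuous fun s => h (s + ε * t) ((s + ε * t) / ε) :=
      c1.comp (continuous_id.add continuous_const)
    have ct : Continuous fun s => h s (s / ε + t) := cshift.comp (continuous_id.prodMk continuous_const)
    have e1 : ∫ s in a..b, h (s + ε * t) ((s + ε * t) / ε)
        = ∫ s in (a + ε * t)..(b + ε * t), h s (s / ε) :=
      intervalIntegral.integral_comp_add_right (fun s => h s (s / ε)) (ε * t)
    have i1 : ∀ x y : ℝ, IntervalIntegrable (fun s => h s (s / ε)) MeasureTheory.volume x y :=
      fun x y => c1.intervalIntegrable x y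
    have e2 : I - ∫ s in (a + ε * t)..(b + ε * t), h s (s / ε)
        = (∫ s in a..(a + ε * t), h s (s / ε)) - ∫ s in b..(b + ε * t), h s (s / ε) :=
      intervalIntegral.integral_interval_sub_interval_comm (i1 _ _) (i1 _ _) (i1 _ _)
    have bd : ∀ x : ℝ, ‖∫ s in x..(x + ε * t), h s (s / ε)‖ ≤ H * ε := by
      intro x
      refine (intervalIntegral.norm_integral_le_of_norm_le_const
        (fun s _ => hH s (s / ε))).trans ?_
      rw [add_sub_cancel_left, abs_of_nonneg (mul_nonneg hε.le ht.1)]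
      exact mul_le_mul_of_nonneg_left (mul_le_of_le_one_right hε.le ht.2) hH0
    have e3 : ‖(∫ s in a..b, h (s + ε * t) ((s + ε * t) / ε)) - J t‖ ≤ ω * (b - a) := by
      rw [hJ, ← intervalIntegral.integral_sub (cs.intervalIntegrable _ _)
        (ct.intervalIntegrable _ _), ← abs_of_nonneg (sub_nonneg.2 hab)]
      refine intervalIntegral.norm_integral_le_of_norm_le_const fun s _ => ?_
      have : (s + ε * t) / ε = s / ε + t := by field_simp
      rw [this]
      refine hω _ _ _ ?_
      rw [add_sub_cancel_left, abs_of_nonneg (mul_nonneg hε.le ht.1)]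
      exact mul_le_of_le_one_right hε.le ht.2
    calc ‖I - J t‖ = ‖(I - ∫ s in (a + ε * t)..(b + ε * t), h s (s / ε))
          + ((∫ s in a..b, h (s + ε * t) ((s + ε * t) / ε)) - J t)‖ := by
          rw [e1]; congr 1; abel
      _ ≤ (H * ε + H * ε) + ω * (b - a) := by
          refine (norm_add_le _ _).trans (add_le_add ?_ e3)
          rw [e2]
          exact (norm_sub_le _ _).trans (add_le_add (bd a) (bd b))
      _ = ω * (b - a) + 2 * H * ε := by ring
  have e4 : ∫ s in a..b, (h s (s / ε) - cellMean (h s)) = ∫ t in (0 : ℝ)..1, (I - J t) := by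
    rw [intervalIntegral.integral_sub (c1.intervalIntegrable _ _) (c2.intervalIntegrable _ _),
      hswap, intervalIntegral.integral_sub (continuous_const.intervalIntegrable _ _)
      (cJ.intervalIntegrable _ _)]
    simp [hI]
  rw [e4]
  have := intervalIntegral.norm_integral_le_of_norm_le_const (a := (0 : ℝ)) (b := 1)
    (f := fun t => I - J t) (C := ω * (b - a) + 2 * H * ε)
    (fun t ht => key t (by rw [uIoc_of_le zero_le_one] at ht; exact ⟨ht.1.le, ht.2⟩))
  simpa using this

/-- The projection of `ℝ` onto `[0,1]`. -/
noncomputable def proj01 (x : ℝ) : ℝ := projIcc (0 : ℝ) 1 zero_le_one x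

theorem continuous_proj01 : Continuous proj01 := continuous_subtype_val.comp continuous_projIcc

theorem proj01_mem (x : ℝ) : proj01 x ∈ Icc (0 : ℝ) 1 := (projIcc (0 : ℝ) 1 zero_le_one x).2

theorem proj01_of_mem {x : ℝ} (hx : x ∈ Icc (0 : ℝ) 1) : proj01 x = x :=
  congrArg Subtype.val (projIcc_of_mem zero_le_one hx)

theorem abs_proj01_sub_le (x y : ℝ) : |proj01 x - proj01 y| ≤ |x - y| :=
  abs_projIcc_sub_projIcc zero_le_one

theorem monotone_proj01 : Monotone proj01 := fun _ _ hxy =>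
  Subtype.coe_le_coe.2 (monotone_projIcc zero_le_one hxy)

@[simp] theorem proj01_proj01 (x : ℝ) : proj01 (proj01 x) = proj01 x :=
  proj01_of_mem (proj01_mem x)

theorem Function.Periodic.apply_fract {Y : Type*} {h : ℝ → Y} (hper : ∀ y, h (y + 1) = h y)
    (y : ℝ) : h (Int.fract y) = h y := by
  have hp : Function.Periodic h 1 := hper
  have := hp.sub_int_mul_eq (x := y) ⌊y⌋
  rwa [mul_one] at this

theorem fract_mem_Icc (y : ℝ) : Int.fract y ∈ Icc (0 : ℝ) 1 :=
  ⟨Int.fract_nonneg y, (Int.fract_lt_one y).le⟩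

variable {Z W : Type*} [PseudoMetricSpace Z] [NormedAddCommGroup W]

/-- A map on `[0,1] × ℝ × Z`, periodic in the second variable, that is continuous at all points over
the graph of `ζ`, is continuous there uniformly. -/
theorem exists_uniform_near_graph {Φ : ℝ → ℝ → Z → W} {ζ : ℝ → Z} (hζ : Continuous ζ)
    (hζp : ∀ x, ζ (proj01 x) = ζ x) (hp : ∀ x y z, Φ (proj01 x) y z = Φ x y z)
    (hper : ∀ x y z, Φ x (y + 1) z = Φ x y z)
    (hc : ∀ x y, ContinuousAt (fun w : ℝ × ℝ × Z => Φ w.1 w.2.1 w.2.2) (x, y, ζ x))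
    {κ : ℝ} (hκ : 0 < κ) :
    ∃ δ > 0, ∀ x y z, dist z (ζ x) < δ → ‖Φ x y z - Φ x y (ζ x)‖ < κ := by
  set S : Set (ℝ × ℝ × Z) := (fun p : ℝ × ℝ => (p.1, p.2, ζ p.1)) '' (Icc 0 1 ×ˢ Icc 0 1)
  have hS : IsCompact S := (isCompact_Icc.prod isCompact_Icc).image (by fun_prop)
  have hcS : ∀ w ∈ S, ContinuousAt (fun w : ℝ × ℝ × Z => Φ w.1 w.2.1 w.2.2) w := by
    rintro _ ⟨p, _, rfl⟩
    exact hc _ _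
  -- Only one of the two points compared has to lie in the compact set, so `z` may leave the graph.
  have h := hS.uniformContinuousAt_of_continuousAt _ hcS (Metric.dist_mem_uniformity hκ)
  obtain ⟨δ, hδ, h⟩ := Metric.mem_uniformity_dist.1 h
  refine ⟨δ, hδ, fun x y z hz => ?_⟩
  have := @h (proj01 x, Int.fract y, ζ (proj01 x)) (proj01 x, Int.fract y, z)
    (by simpa [Prod.dist_eq, hδ, hζp, dist_comm] using hz)
    ⟨(proj01 x, Int.fract y), ⟨proj01_mem x, fract_mem_Icc y⟩, rfl⟩
  simp only [mem_ofPred_eq, hp, hζp] at this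
  rw [Function.Periodic.apply_fract (h := fun y => Φ x y (ζ x)) (fun y => hper x y _),
    Function.Periodic.apply_fract (h := fun y => Φ x y z) (fun y => hper x y _), dist_comm,
    dist_eq_norm] at this
  exact this

/-- Uniform continuity, over a compact set, of a map on `[0,1] × ℝ × Z` that is periodic in the
second variable. -/
theorem exists_uniform_modulus {Φ : ℝ → ℝ → Z → W} {S : Set Z} (hS : IsCompact S)
    (hp : ∀ x y z, Φ (proj01 x) y z = Φ x y z) (hper : ∀ x y z, Φ x (y + 1) z = Φ x y z)
    (hc : Continuous fun w : ℝ × ℝ × Z => Φ w.1 w.2.1 w.2.2) {κ : ℝ} (hκ : 0 < κ) :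
    ∃ δ > 0, ∀ x x' y, ∀ z ∈ S, ∀ z', |x - x'| < δ → dist z z' < δ →
      ‖Φ x y z - Φ x' y z'‖ < κ := by
  have hK : IsCompact (Icc (0 : ℝ) 1 ×ˢ Icc (0 : ℝ) 1 ×ˢ S) :=
    isCompact_Icc.prod (isCompact_Icc.prod hS)
  have h := hK.uniformContinuousAt_of_continuousAt _ (fun w _ => hc.continuousAt)
    (Metric.dist_mem_uniformity hκ)
  obtain ⟨δ, hδ, h⟩ := Metric.mem_uniformity_dist.1 h
  refine ⟨δ, hδ, fun x x' y z hz z' hx hzz => ?_⟩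
  have := @h (proj01 x, Int.fract y, z) (proj01 x', Int.fract y, z')
    (by
      simp only [Prod.dist_eq, dist_self, sup_lt_iff, hδ, hzz, and_true, Real.dist_eq]
      exact (abs_proj01_sub_le x x').trans_lt hx)
    ⟨proj01_mem x, fract_mem_Icc y, hz⟩
  simp only [mem_ofPred_eq, hp] at this
  rw [Function.Periodic.apply_fract (h := fun y => Φ x y z) (fun y => hper x y _),
    Function.Periodic.apply_fract (h := fun y => Φ x' y z') (fun y => hper x' y _),
    dist_eq_norm] at this
  exact this

theorem exists_uniform_bound {Φ : ℝ → ℝ → Z → W} {S : Set Z} (hS : IsCompact S)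
    (hp : ∀ x y z, Φ (proj01 x) y z = Φ x y z) (hper : ∀ x y z, Φ x (y + 1) z = Φ x y z)
    (hc : Continuous fun w : ℝ × ℝ × Z => Φ w.1 w.2.1 w.2.2) :
    ∃ H > 0, ∀ x y, ∀ z ∈ S, ‖Φ x y z‖ ≤ H := by
  have hK : IsCompact (Icc (0 : ℝ) 1 ×ˢ Icc (0 : ℝ) 1 ×ˢ S) :=
    isCompact_Icc.prod (isCompact_Icc.prod hS)
  obtain ⟨H, hH⟩ := hK.exists_bound_of_continuousOn hc.continuousOn
  refine ⟨max H 1, by positivity, fun x y z hz => ?_⟩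
  have := hH (proj01 x, Int.fract y, z) ⟨proj01_mem x, fract_mem_Icc y, hz⟩
  simp only [hp] at this
  rw [Function.Periodic.apply_fract (h := fun y => Φ x y z) (fun y => hper x y _)] at this
  exact this.trans (le_max_left _ _)

end Averaging

/-! ### A fixed point principle -/

/-- A quantitative Newton–Kantorovich principle with approximate inverse `P`. -/
theorem exists_fixedPoint_of_approximate_inverse {E : Type*} [NormedAddCommGroup E]
    [NormedSpace ℝ E] [CompleteSpace E] {T : E → E} {L P : E →L[ℝ] E} {z₀ : E} {r κ θ : ℝ}
    (hr : 0 ≤ r)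
    (hT : ∀ z z', ‖z - z₀‖ ≤ r → ‖z' - z₀‖ ≤ r → ‖T z - T z' - L (z - z')‖ ≤ κ * ‖z - z'‖)
    (hP : ∀ v, ‖v - P (v - L v)‖ ≤ θ * ‖v‖) (hsmall : θ + ‖P‖ * κ ≤ 1 / 2)
    (hinj : ∀ v, P v = 0 → v = 0) (hres : ‖P‖ * ‖T z₀ - z₀‖ ≤ r / 2) :
    ∃ z, ‖z - z₀‖ ≤ r ∧ T z = z ∧ ‖z - z₀‖ ≤ 2 * ‖P‖ * ‖T z₀ - z₀‖ ∧
      ∀ z', ‖z' - z₀‖ ≤ r → T z' = z' → z' = z := by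
  -- The linear part of `N` is `1 - P (1 - L)`, which `hP` makes small, and the remainder of `T`
  -- costs `‖P‖ * κ`. Injectivity of `P` prevents spurious fixed points, so `1 - L` need not be
  -- known to be invertible.
  set N : E → E := fun z => z - P (z - T z) with hN
  have hcontr : ∀ z z', ‖z - z₀‖ ≤ r → ‖z' - z₀‖ ≤ r → ‖N z - N z'‖ ≤ 1 / 2 * ‖z - z'‖ := by
    intro z z' hz hz'
    have e : N z - N z' = ((z - z') - P ((z - z') - L (z - z')))
        + P (T z - T z' - L (z - z')) := by
      simp only [hN, map_sub]; abel
    rw [e]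
    calc _ ≤ θ * ‖z - z'‖ + ‖P‖ * (κ * ‖z - z'‖) :=
          (norm_add_le _ _).trans (add_le_add (hP _)
            ((P.le_opNorm _).trans (mul_le_mul_of_nonneg_left (hT z z' hz hz') (norm_nonneg _))))
      _ = (θ + ‖P‖ * κ) * ‖z - z'‖ := by ring
      _ ≤ _ := mul_le_mul_of_nonneg_right hsmall (norm_nonneg _)
  have hfix : ∀ z, N z = z ↔ T z = z := by
    intro z
    constructor
    · intro h
      have : P (z - T z) = 0 := by simpa [hN] using h
      exact (sub_eq_zero.1 (hinj _ this)).symm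
    · intro h
      simp [hN, h]
  have h0 : ‖N z₀ - z₀‖ ≤ ‖P‖ * ‖T z₀ - z₀‖ := by
    have : N z₀ - z₀ = P (T z₀ - z₀) := by simp only [hN, map_sub]; abel
    rw [this]
    exact P.le_opNorm _
  have hz₀ : ‖z₀ - z₀‖ ≤ r := by simpa
  have hmaps : MapsTo N (Metric.closedBall z₀ r) (Metric.closedBall z₀ r) := by
    intro z hz
    rw [mem_closedBall_iff_norm] at hz ⊢
    calc ‖N z - z₀‖ = ‖(N z - N z₀) + (N z₀ - z₀)‖ := by congr 1; abel
      _ ≤ 1 / 2 * ‖z - z₀‖ + r / 2 :=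
        (norm_add_le _ _).trans (add_le_add (hcontr _ _ hz hz₀) (h0.trans hres))
      _ ≤ r := by linarith
  have hlip : ContractingWith (1 / 2) (hmaps.restrict N _ _) := by
    refine ⟨by
      rw [← NNReal.coe_lt_coe]; norm_num, LipschitzWith.of_dist_le_mul fun z z' => ?_⟩
    have := hcontr z z' (mem_closedBall_iff_norm.1 z.2) (mem_closedBall_iff_norm.1 z'.2)
    simpa [Subtype.dist_eq, dist_eq_norm] using this
  obtain ⟨z, hz, hNz, -, -⟩ := ContractingWith.exists_fixedPoint'
    (Metric.isClosed_closedBall.isComplete) hmaps hlip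
    (show z₀ ∈ Metric.closedBall z₀ r from Metric.mem_closedBall_self hr) (edist_ne_top _ _)
  rw [mem_closedBall_iff_norm] at hz
  have hNz : N z = z := hNz
  refine ⟨z, hz, (hfix z).1 hNz, ?_, fun z' hz' hTz' => ?_⟩
  · have h1 : ‖z - z₀‖ ≤ 1 / 2 * ‖z - z₀‖ + ‖P‖ * ‖T z₀ - z₀‖ := by
      calc ‖z - z₀‖ = ‖(N z - N z₀) + (N z₀ - z₀)‖ := by rw [hNz]; congr 1; abel
        _ ≤ _ := (norm_add_le _ _).trans (add_le_add (hcontr _ _ hz hz₀) h0)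
    linarith
  · have h1 := hcontr z' z hz' hz
    rw [hNz, (hfix z').2 hTz'] at h1
    have : ‖z' - z‖ ≤ 0 := by linarith
    exact sub_eq_zero.1 (norm_le_zero_iff.1 this)

/-! ### Integral operators of the boundary value problem -/

section BoundaryValueOperator

open BoundedContinuousFunction

variable {X : Type*} [NormedAddCommGroup X]

/-- Constant extension to `ℝ` of a function on `[0,1]`. -/
noncomputable def extend01 (v : Icc (0 : ℝ) 1 →ᵇ X) (x : ℝ) : X := v (projIcc 0 1 zero_le_one x)

theorem continuous_extend01 (v : Icc (0 : ℝ) 1 →ᵇ X) : Continuous (extend01 v) :=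
  v.continuous.comp continuous_projIcc

@[simp] theorem extend01_proj01 (v : Icc (0 : ℝ) 1 →ᵇ X) (x : ℝ) :
    extend01 v (proj01 x) = extend01 v x := by
  simp [extend01, proj01]

@[simp] theorem extend01_coe (v : Icc (0 : ℝ) 1 →ᵇ X) (x : Icc (0 : ℝ) 1) :
    extend01 v x = v x := by
  simp [extend01]

theorem norm_extend01_le (v : Icc (0 : ℝ) 1 →ᵇ X) (x : ℝ) : ‖extend01 v x‖ ≤ ‖v‖ :=
  v.norm_coe_le_norm _

variable [NormedSpace ℝ X]

/-- The solution operator of `z' = h` with boundary conditions given by the projection `B`. -/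
noncomputable def bvpIntegral (B : X →L[ℝ] X) (h : ℝ → X) (x : ℝ) : X :=
  (∫ s in (0 : ℝ)..x, h s) - B (∫ s in (0 : ℝ)..1, h s)

theorem continuous_bvpIntegral (B : X →L[ℝ] X) {h : ℝ → X} (hh : Continuous h) :
    Continuous (bvpIntegral B h) :=
  (intervalIntegral.continuous_primitive (fun a b => hh.intervalIntegrable a b) 0).sub
    continuous_const

/-- The solution operator `bvpIntegral` as a map into the bounded continuous functions. -/
noncomputable def bvpSolve (B : X →L[ℝ] X) (h : C(ℝ, X)) : Icc (0 : ℝ) 1 →ᵇ X :=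
  BoundedContinuousFunction.mkOfCompact
    ⟨fun x => bvpIntegral B h x, (continuous_bvpIntegral B h.continuous).comp
      continuous_subtype_val⟩

theorem bvpSolve_apply (B : X →L[ℝ] X) (h : C(ℝ, X)) (x : Icc (0 : ℝ) 1) :
    bvpSolve B h x = bvpIntegral B h x := rfl

theorem bvpSolve_add (B : X →L[ℝ] X) (h k : C(ℝ, X)) :
    bvpSolve B (h + k) = bvpSolve B h + bvpSolve B k := by
  ext x
  have hi : ∀ (h : C(ℝ, X)) (a b : ℝ), IntervalIntegrable h MeasureTheory.volume a b :=
    fun h a b => h.continuous.intervalIntegrable a b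
  simp only [bvpSolve_apply, BoundedContinuousFunction.add_apply, bvpIntegral,
    ContinuousMap.add_apply]
  rw [intervalIntegral.integral_add (hi h _ _) (hi k _ _),
    intervalIntegral.integral_add (hi h _ _) (hi k _ _), map_add]
  abel

theorem bvpSolve_smul (B : X →L[ℝ] X) (c : ℝ) (h : C(ℝ, X)) :
    bvpSolve B (c • h) = c • bvpSolve B h := by
  ext x
  simp [bvpSolve_apply, bvpIntegral, smul_sub]

theorem bvpSolve_sub (B : X →L[ℝ] X) (h k : C(ℝ, X)) :
    bvpSolve B (h - k) = bvpSolve B h - bvpSolve B k := by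
  have : h - k = h + (-1 : ℝ) • k := by simp [sub_eq_add_neg]
  rw [this, bvpSolve_add, bvpSolve_smul]
  simp [sub_eq_add_neg]

theorem norm_bvpSolve_le (B : X →L[ℝ] X) (h : C(ℝ, X)) {c : ℝ}
    (hc : ∀ x ∈ Icc (0 : ℝ) 1, ‖∫ s in (0 : ℝ)..x, h s‖ ≤ c) :
    ‖bvpSolve B h‖ ≤ (1 + ‖B‖) * c := by
  have hc0 : 0 ≤ c := (norm_nonneg _).trans (hc 0 (by simp))
  refine (BoundedContinuousFunction.norm_le (by positivity)).2 fun x => ?_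
  rw [bvpSolve_apply, bvpIntegral]
  calc _ ≤ c + ‖B‖ * c := (norm_sub_le _ _).trans (add_le_add (hc x x.2)
        ((B.le_opNorm _).trans (mul_le_mul_of_nonneg_left (hc 1 (by simp)) (norm_nonneg _))))
    _ = _ := by ring

theorem norm_integral_le_of_bound01 {h : ℝ → X} {c : ℝ} (hc : ∀ s ∈ Icc (0 : ℝ) 1, ‖h s‖ ≤ c)
    {x y : ℝ} (hx : x ∈ Icc (0 : ℝ) 1) (hy : y ∈ Icc (0 : ℝ) 1) :
    ‖∫ s in x..y, h s‖ ≤ c * |y - x| := by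
  refine intervalIntegral.norm_integral_le_of_norm_le_const fun s hs => hc s ?_
  exact uIcc_subset_Icc hx hy (uIoc_subset_uIcc hs)

theorem norm_bvpSolve_le_of_bound (B : X →L[ℝ] X) (h : C(ℝ, X)) {c : ℝ}
    (hc : ∀ s ∈ Icc (0 : ℝ) 1, ‖h s‖ ≤ c) : ‖bvpSolve B h‖ ≤ (1 + ‖B‖) * c := by
  have hc0 : 0 ≤ c := (norm_nonneg _).trans (hc 0 (by simp))
  refine norm_bvpSolve_le B h fun x hx => ?_
  refine (norm_integral_le_of_bound01 hc (by simp) hx).trans ?_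
  rw [sub_zero, abs_of_nonneg hx.1]
  exact mul_le_of_le_one_right hc0 hx.2

/-- The boundary term is constant in `x` and cancels. This is the gain of regularity: a sup bound on
the integrand alone, hence a bound independent of `ε`, controls the Lipschitz constant. -/
theorem norm_bvpSolve_sub_le (B : X →L[ℝ] X) (h : C(ℝ, X)) {c : ℝ}
    (hc : ∀ s ∈ Icc (0 : ℝ) 1, ‖h s‖ ≤ c) (x y : Icc (0 : ℝ) 1) :
    ‖bvpSolve B h x - bvpSolve B h y‖ ≤ c * |(x : ℝ) - y| := by
  have e : bvpSolve B h x - bvpSolve B h y = ∫ s in (y : ℝ)..x, h s := by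
    simp only [bvpSolve_apply, bvpIntegral, sub_sub_sub_cancel_right]
    exact intervalIntegral.integral_interval_sub_left (h.continuous.intervalIntegrable _ _)
      (h.continuous.intervalIntegrable _ _)
  rw [e]
  exact norm_integral_le_of_bound01 hc y.2 x.2

/-- The integral operator `v ↦ bvpSolve B (A v)` with a coefficient function `A`. -/
noncomputable def bvpLinear (B : X →L[ℝ] X) (A : C(ℝ, X →L[ℝ] X)) :
    (Icc (0 : ℝ) 1 →ᵇ X) →L[ℝ] (Icc (0 : ℝ) 1 →ᵇ X) :=
  LinearMap.mkContinuousOfExistsBound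
    { toFun := fun v => bvpSolve B
        ⟨fun s => A s (extend01 v s), A.continuous.clm_apply (continuous_extend01 v)⟩
      map_add' := fun v w => by
        rw [← bvpSolve_add]
        congr 1
        ext s
        simp [extend01]
      map_smul' := fun c v => by
        rw [RingHom.id_apply, ← bvpSolve_smul]
        congr 1
        ext s
        simp [extend01] }
    (by
      obtain ⟨c, hc⟩ := isCompact_Icc.exists_bound_of_continuousOn
        (s := Icc (0 : ℝ) 1) A.continuous.continuousOn
      have hc0 : 0 ≤ c := (norm_nonneg _).trans (hc 0 (by simp))
      refine ⟨(1 + ‖B‖) * c, fun v => ?_⟩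
      rw [mul_assoc]
      refine norm_bvpSolve_le_of_bound B _ fun s hs => ?_
      exact ((A s).le_opNorm _).trans
        (mul_le_mul (hc s hs) (norm_extend01_le v s) (norm_nonneg _) hc0))

theorem bvpLinear_apply (B : X →L[ℝ] X) (A : C(ℝ, X →L[ℝ] X)) (v : Icc (0 : ℝ) 1 →ᵇ X) :
    bvpLinear B A v = bvpSolve B
      ⟨fun s => A s (extend01 v s), A.continuous.clm_apply (continuous_extend01 v)⟩ := rfl

theorem norm_bvpLinear_apply_le (B : X →L[ℝ] X) {A : C(ℝ, X →L[ℝ] X)} {c : ℝ}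
    (hc : ∀ s ∈ Icc (0 : ℝ) 1, ‖A s‖ ≤ c) (v : Icc (0 : ℝ) 1 →ᵇ X) :
    ‖bvpLinear B A v‖ ≤ (1 + ‖B‖) * c * ‖v‖ := by
  have hc0 : 0 ≤ c := (norm_nonneg _).trans (hc 0 (by simp))
  rw [mul_assoc, bvpLinear_apply]
  refine norm_bvpSolve_le_of_bound B _ fun s hs => ?_
  exact ((A s).le_opNorm _).trans
    (mul_le_mul (hc s hs) (norm_extend01_le v s) (norm_nonneg _) hc0)

theorem norm_bvpLinear_sub_le (B : X →L[ℝ] X) {A : C(ℝ, X →L[ℝ] X)} {c : ℝ}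
    (hc : ∀ s ∈ Icc (0 : ℝ) 1, ‖A s‖ ≤ c) (v : Icc (0 : ℝ) 1 →ᵇ X) (x y : Icc (0 : ℝ) 1) :
    ‖bvpLinear B A v x - bvpLinear B A v y‖ ≤ c * ‖v‖ * |(x : ℝ) - y| := by
  have hc0 : 0 ≤ c := (norm_nonneg _).trans (hc 0 (by simp))
  refine norm_bvpSolve_sub_le B _ (fun s hs => ?_) x y
  exact ((A s).le_opNorm _).trans
    (mul_le_mul (hc s hs) (norm_extend01_le v s) (norm_nonneg _) hc0)

/-- The image of the unit ball is bounded and uniformly Lipschitz, so Arzelà–Ascoli applies. -/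
theorem isCompactOperator_bvpLinear [FiniteDimensional ℝ X] (B : X →L[ℝ] X)
    (A : C(ℝ, X →L[ℝ] X)) : IsCompactOperator (bvpLinear B A) := by
  obtain ⟨c, hc⟩ := isCompact_Icc.exists_bound_of_continuousOn
    (s := Icc (0 : ℝ) 1) A.continuous.continuousOn
  have hc0 : 0 ≤ c := (norm_nonneg _).trans (hc 0 (by simp))
  have : ProperSpace X := FiniteDimensional.proper ℝ X
  refine (isCompactOperator_iff_isCompact_closure_image_ball
    (bvpLinear B A : (Icc (0 : ℝ) 1 →ᵇ X) →ₗ[ℝ] (Icc (0 : ℝ) 1 →ᵇ X)) one_pos).2 ?_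
  refine BoundedContinuousFunction.arzela_ascoli (Metric.closedBall 0 ((1 + ‖B‖) * c))
    (isCompact_closedBall _ _) _ ?_ ?_
  · rintro _ x ⟨v, hv, rfl⟩
    rw [mem_closedBall_zero_iff]
    refine ((bvpLinear B A v).norm_coe_le_norm x).trans
      ((norm_bvpLinear_apply_le B hc v).trans ?_)
    exact mul_le_of_le_one_right (by positivity) (mem_ball_zero_iff.1 hv).le
  · refine Metric.equicontinuous_of_continuity_modulus (fun t => c * t) ?_ _ ?_
    · have : Continuous fun t : ℝ => c * t := by fun_prop
      simpa using this.tendsto 0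
    · rintro x y ⟨_, v, hv, rfl⟩
      rw [dist_eq_norm, Subtype.dist_eq, Real.dist_eq]
      refine (norm_bvpLinear_sub_le B hc v x y).trans ?_
      exact mul_le_mul_of_nonneg_right (mul_le_of_le_one_right hc0 (mem_ball_zero_iff.1 hv).le)
        (abs_nonneg _)

end BoundaryValueOperator

/-! ### The averaging principle for nondegenerate solutions -/

section AveragedProblem

open BoundedContinuousFunction

variable {X : Type*} [NormedAddCommGroup X]

/-- `Φ` is continuous on `[0,1] × ℝ × Z`, extended constantly in the first variable, and
`1`-periodic in the second one. -/
structure IsCellFunction {Z W : Type*} [TopologicalSpace Z] [TopologicalSpace W]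
    (Φ : ℝ → ℝ → Z → W) : Prop where
  continuous : Continuous fun w : ℝ × ℝ × Z => Φ w.1 w.2.1 w.2.2
  proj : ∀ x y z, Φ (proj01 x) y z = Φ x y z
  periodic : ∀ x y z, Φ x (y + 1) z = Φ x y z

/-- The same for functions without a third variable. -/
structure IsCellCoefficient {W : Type*} [TopologicalSpace W] (A : ℝ → ℝ → W) : Prop where
  continuous : Continuous (Function.uncurry A)
  proj : ∀ x y, A (proj01 x) y = A x y
  periodic : ∀ x y, A x (y + 1) = A x y

theorem IsCellCoefficient.toCellFunction {W : Type*} [TopologicalSpace W] {A : ℝ → ℝ → W}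
    (hA : IsCellCoefficient A) : IsCellFunction fun x y (_ : Unit) => A x y :=
  ⟨hA.continuous.comp (continuous_fst.prodMk (continuous_fst.comp continuous_snd)),
    fun x y _ => hA.proj x y, fun x y _ => hA.periodic x y⟩

theorem IsCellCoefficient.continuous_oscillating {W : Type*} [TopologicalSpace W] {A : ℝ → ℝ → W}
    (hA : IsCellCoefficient A) (ε : ℝ) : Continuous fun s => A s (s / ε) :=
  hA.continuous.comp (continuous_id.prodMk (continuous_id.div_const ε))

theorem IsCellFunction.comp {W Z : Type*} [TopologicalSpace W] [TopologicalSpace Z]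
    {Φ : ℝ → ℝ → Z → W} (hΦ : IsCellFunction Φ) {ζ : ℝ → Z} (hζ : Continuous ζ)
    (hζp : ∀ x, ζ (proj01 x) = ζ x) : IsCellCoefficient fun x y => Φ x y (ζ x) where
  continuous := hΦ.continuous.comp
    (continuous_fst.prodMk (continuous_snd.prodMk (hζ.comp continuous_fst)))
  proj x y := by rw [hζp, hΦ.proj]
  periodic x y := hΦ.periodic _ _ _

theorem IsCellCoefficient.exists_bound {W : Type*} [NormedAddCommGroup W] {A : ℝ → ℝ → W}
    (hA : IsCellCoefficient A) : ∃ H > 0, ∀ x y, ‖A x y‖ ≤ H := by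
  obtain ⟨H, hH, h⟩ := exists_uniform_bound (Φ := fun x y (_ : Unit) => A x y) (isCompact_singleton (x := ()))
    hA.toCellFunction.proj hA.toCellFunction.periodic hA.toCellFunction.continuous
  exact ⟨H, hH, fun x y => h x y () rfl⟩

theorem IsCellCoefficient.exists_modulus {W : Type*} [NormedAddCommGroup W] {A : ℝ → ℝ → W}
    (hA : IsCellCoefficient A) {κ : ℝ} (hκ : 0 < κ) :
    ∃ δ > 0, ∀ x x' y, |x - x'| < δ → ‖A x y - A x' y‖ < κ := by
  obtain ⟨δ, hδ, h⟩ := exists_uniform_modulus (Φ := fun x y (_ : Unit) => A x y)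
    (isCompact_singleton (x := ()))
    hA.toCellFunction.proj hA.toCellFunction.periodic hA.toCellFunction.continuous hκ
  exact ⟨δ, hδ, fun x x' y hx => h x x' y () rfl () hx (by simpa using hδ)⟩

variable [NormedSpace ℝ X] [CompleteSpace X]

theorem norm_bvpSolve_oscillating_sub_le (B : X →L[ℝ] X) {h : ℝ → ℝ → X}
    (hh : IsCellCoefficient h) {H ω ε : ℝ} (hε : 0 < ε) (hH : ∀ s y, ‖h s y‖ ≤ H)
    (hω : ∀ s s' y, |s - s'| ≤ ε → ‖h s y - h s' y‖ ≤ ω) :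
    ‖bvpSolve B ⟨fun s => h s (s / ε), hh.continuous_oscillating ε⟩
      - bvpSolve B ⟨fun s => cellMean (h s), continuous_cellMean hh.continuous⟩‖
      ≤ (1 + ‖B‖) * (ω + 2 * H * ε) := by
  have hω0 : 0 ≤ ω := (norm_nonneg _).trans (hω 0 0 0 (by simpa using hε.le))
  rw [← bvpSolve_sub]
  refine norm_bvpSolve_le B _ fun x hx => ?_
  refine (norm_integral_oscillating_sub_mean_le hh.continuous hh.periodic hε hH hω hx.1).trans ?_
  rw [sub_zero]
  have := mul_le_of_le_one_right hω0 hx.2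
  linarith

/-- A function `v` oscillating at frequency `1 / ε` could resonate with the coefficient, so a
Lipschitz bound on `v` is imposed. Under it `s ↦ D s y (v s)` has a modulus of continuity uniform in
`y` and proportional to `Λ`. -/
theorem exists_bvpLinear_oscillating_sub_le (B : X →L[ℝ] X) {D : ℝ → ℝ → X →L[ℝ] X}
    (hD : IsCellCoefficient D) {κ : ℝ} (hκ : 0 < κ) :
    ∃ ε₁ > 0, ∀ ε ∈ Ioc 0 ε₁, ∀ (Λ : ℝ) (v : Icc (0 : ℝ) 1 →ᵇ X), ‖v‖ ≤ Λ →
      (∀ x y : Icc (0 : ℝ) 1, ‖v x - v y‖ ≤ Λ * |(x : ℝ) - y|) →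
      ‖bvpLinear B ⟨fun s => D s (s / ε), hD.continuous_oscillating ε⟩ v
        - bvpLinear B ⟨fun s => cellMean (D s), continuous_cellMean hD.continuous⟩ v‖ ≤ κ * Λ := by
  obtain ⟨H, hH0, hH⟩ := hD.exists_bound
  -- One `k` pays for the modulus of `D`, the other for `3 * H * ε`: one `H * ε` from the Lipschitz
  -- constant of `v`, two from the end pieces.
  set k : ℝ := κ / (2 * (1 + ‖B‖)) with hk
  have hk0 : 0 < k := by positivity
  obtain ⟨δ, hδ, hmod⟩ := hD.exists_modulus hk0
  refine ⟨min (δ / 2) (k / (3 * H)), by positivity, fun ε hε Λ v hv hlip => ?_⟩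
  have hΛ : 0 ≤ Λ := (norm_nonneg _).trans hv
  have hε0 : 0 < ε := hε.1
  have hεδ : ε < δ := by linarith [hε.2.trans (min_le_left _ _)]
  have hεH : 3 * H * ε ≤ k := by
    have := hε.2.trans (min_le_right _ _)
    rwa [le_div_iff₀' (by positivity)] at this
  have hh : IsCellCoefficient fun s y => D s y (extend01 v s) :=
    ⟨hD.continuous.clm_apply ((continuous_extend01 v).comp continuous_fst),
      fun x y => by rw [hD.proj, extend01_proj01], fun x y => by rw [hD.periodic]⟩
  have hbd : ∀ s y, ‖D s y (extend01 v s)‖ ≤ H * Λ := fun s y =>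
    ((D s y).le_opNorm _).trans (mul_le_mul (hH s y) ((norm_extend01_le v s).trans hv)
      (norm_nonneg _) hH0.le)
  have hω : ∀ s s' y, |s - s'| ≤ ε →
      ‖D s y (extend01 v s) - D s' y (extend01 v s')‖ ≤ k * Λ + H * (Λ * ε) := by
    intro s s' y hs
    have e : D s y (extend01 v s) - D s' y (extend01 v s')
        = (D s y - D s' y) (extend01 v s) + D s' y (extend01 v s - extend01 v s') := by
      simp
    rw [e]
    refine (norm_add_le _ _).trans (add_le_add ?_ ?_)
    · exact ((D s y - D s' y).le_opNorm _).trans (mul_le_mul (hmod s s' y (hs.trans_lt hεδ)).le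
        ((norm_extend01_le v s).trans hv) (norm_nonneg _) hk0.le)
    · refine ((D s' y).le_opNorm _).trans (mul_le_mul (hH s' y) ?_ (norm_nonneg _) hH0.le)
      refine (hlip _ _).trans (mul_le_mul_of_nonneg_left ?_ hΛ)
      exact (abs_proj01_sub_le s s').trans hs
  have hmean : ∀ s, cellMean (fun y => D s y (extend01 v s)) = cellMean (D s) (extend01 v s) := by
    intro s
    rw [cellMean, cellMean]
    have hc : Continuous (D s) := hD.continuous.comp (continuous_const.prodMk continuous_id)
    exact (ContinuousLinearMap.intervalIntegral_apply (hc.intervalIntegrable _ _) _).symm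
  have := norm_bvpSolve_oscillating_sub_le B hh hε0 hbd hω
  rw [bvpLinear_apply, bvpLinear_apply]
  simp only [hmean] at this
  refine this.trans ?_
  have e1 : (1 + ‖B‖) * (2 * k) = κ := by rw [hk]; field_simp
  have h3 : 3 * H * ε * Λ ≤ k * Λ := mul_le_mul_of_nonneg_right hεH hΛ
  calc (1 + ‖B‖) * (k * Λ + H * (Λ * ε) + 2 * (H * Λ) * ε)
      = (1 + ‖B‖) * (k * Λ + 3 * H * ε * Λ) := by ring
    _ ≤ (1 + ‖B‖) * (2 * k * Λ) := by
        refine mul_le_mul_of_nonneg_left ?_ (by positivity)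
        linarith
    _ = κ * Λ := by rw [← e1]; ring

/-- The Nemytskii operator of the oscillating problem followed by the solution operator. -/
noncomputable def oscillatingMap (B : X →L[ℝ] X) {G : ℝ → ℝ → X → X} (hG : IsCellFunction G)
    (ε : ℝ) (z : Icc (0 : ℝ) 1 →ᵇ X) : Icc (0 : ℝ) 1 →ᵇ X :=
  bvpSolve B ⟨fun s => G s (s / ε) (extend01 z s),
    (hG.comp (continuous_extend01 z) (extend01_proj01 z)).continuous_oscillating ε⟩

/-- The corresponding map of the averaged problem. -/
noncomputable def averagedMap (B : X →L[ℝ] X) {G : ℝ → ℝ → X → X} (hG : IsCellFunction G)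
    (z : Icc (0 : ℝ) 1 →ᵇ X) : Icc (0 : ℝ) 1 →ᵇ X :=
  bvpSolve B ⟨fun s => cellMean fun y => G s y (extend01 z s),
    continuous_cellMean (hG.comp (continuous_extend01 z) (extend01_proj01 z)).continuous⟩

theorem exists_oscillatingMap_sub_averagedMap_le (B : X →L[ℝ] X) {G : ℝ → ℝ → X → X}
    (hG : IsCellFunction G) (z : Icc (0 : ℝ) 1 →ᵇ X) {κ : ℝ} (hκ : 0 < κ) :
    ∃ ε₁ > 0, ∀ ε ∈ Ioc 0 ε₁, ‖oscillatingMap B hG ε z - averagedMap B hG z‖ ≤ κ := by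
  have hh := hG.comp (continuous_extend01 z) (extend01_proj01 z)
  obtain ⟨H, hH0, hH⟩ := hh.exists_bound
  set k : ℝ := κ / (2 * (1 + ‖B‖)) with hk
  have hk0 : 0 < k := by positivity
  obtain ⟨δ, hδ, hmod⟩ := hh.exists_modulus hk0
  refine ⟨min (δ / 2) (k / (2 * H)), by positivity, fun ε hε => ?_⟩
  have hεδ : ε < δ := by linarith [hε.2.trans (min_le_left _ _)]
  have hεH : 2 * H * ε ≤ k := by
    have := hε.2.trans (min_le_right _ _)
    rwa [le_div_iff₀' (by positivity)] at this
  refine (norm_bvpSolve_oscillating_sub_le B hh hε.1 hH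
    fun s s' y hs => (hmod s s' y (hs.trans_lt hεδ)).le).trans ?_
  calc (1 + ‖B‖) * (k + 2 * H * ε) ≤ (1 + ‖B‖) * (2 * k) :=
        mul_le_mul_of_nonneg_left (by linarith) (by positivity)
    _ = κ := by rw [hk]; field_simp

/-- The source of the rate: with modulus `Λ * ε`, both terms of the averaging estimate are linear in
`ε`. -/
theorem exists_oscillatingMap_sub_averagedMap_le_mul (B : X →L[ℝ] X) {G : ℝ → ℝ → X → X}
    (hG : IsCellFunction G) (z : Icc (0 : ℝ) 1 →ᵇ X) {Λ : ℝ}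
    (hΛ : ∀ s ∈ Icc (0 : ℝ) 1, ∀ s' ∈ Icc (0 : ℝ) 1, ∀ y,
      ‖G s y (extend01 z s) - G s' y (extend01 z s')‖ ≤ Λ * |s - s'|) :
    ∃ C, ∀ ε > 0, ‖oscillatingMap B hG ε z - averagedMap B hG z‖ ≤ C * ε := by
  have hh := hG.comp (continuous_extend01 z) (extend01_proj01 z)
  obtain ⟨H, hH0, hH⟩ := hh.exists_bound
  have hΛ0 : 0 ≤ Λ := by
    have := (norm_nonneg _).trans (hΛ 0 (by simp) 1 (by simp) 0)
    simpa using this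
  refine ⟨(1 + ‖B‖) * (Λ + 2 * H), fun ε hε => ?_⟩
  refine (norm_bvpSolve_oscillating_sub_le B hh (ω := Λ * ε) hε hH fun s s' y hs => ?_).trans ?_
  · rw [← hh.proj s, ← hh.proj s']
    refine (hΛ _ (proj01_mem s) _ (proj01_mem s') y).trans ?_
    exact mul_le_mul_of_nonneg_left ((abs_proj01_sub_le s s').trans hs) hΛ0
  · exact le_of_eq (by ring)

/-- Averaging for nondegenerate boundary value problems of first order systems. -/
theorem exists_unique_oscillatingMap_fixedPoint [FiniteDimensional ℝ X] (B : X →L[ℝ] X)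
    {G : ℝ → ℝ → X → X} (hG : IsCellFunction G) {D : ℝ → ℝ → X →L[ℝ] X}
    (hD : IsCellCoefficient D) {z₀ : Icc (0 : ℝ) 1 →ᵇ X}
    (hlin : ∀ κ > 0, ∃ r > 0, ∀ x y ζ ζ', ‖ζ - extend01 z₀ x‖ ≤ r → ‖ζ' - extend01 z₀ x‖ ≤ r →
      ‖G x y ζ - G x y ζ' - D x y (ζ - ζ')‖ ≤ κ * ‖ζ - ζ'‖)
    (hz₀ : averagedMap B hG z₀ = z₀)
    (hnd : ∀ v, bvpLinear B ⟨fun s => cellMean (D s), continuous_cellMean hD.continuous⟩ v = v →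
      v = 0) {r₁ : ℝ} (hr₁ : 0 < r₁) :
    ∃ r ∈ Ioc 0 r₁, ∃ ε₀ > 0, ∃ C, ∀ ε ∈ Ioc 0 ε₀, ∃ z, ‖z - z₀‖ ≤ r ∧
      oscillatingMap B hG ε z = z ∧ ‖z - z₀‖ ≤ C * ‖oscillatingMap B hG ε z₀ - z₀‖ ∧
      ∀ z', ‖z' - z₀‖ ≤ r → oscillatingMap B hG ε z' = z' → z' = z := by
  set L₀ := bvpLinear B ⟨fun s => cellMean (D s), continuous_cellMean hD.continuous⟩ with hL₀
  obtain ⟨H, hH0, hH⟩ := hD.exists_bound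
  have hmH : ∀ s, ‖cellMean (D s)‖ ≤ H := fun s => norm_cellMean_le (hH s)
  -- Fredholm alternative: for the compact `L₀`, the number `1` is an eigenvalue or in the resolvent
  -- set, and `hnd` excludes the former.
  have hunit : IsUnit (1 - L₀) := by
    rcases (isCompactOperator_bvpLinear B _).hasEigenvalue_or_mem_resolventSet
      (T := L₀) (one_ne_zero (α := ℝ)) with h | h
    · obtain ⟨v, hv, hv0⟩ := h.exists_hasEigenvector
      rw [Module.End.mem_eigenspace_iff, one_smul] at hv
      exact absurd (hnd v hv) hv0
    · simpa [spectrum.mem_resolventSet_iff] using h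
  obtain ⟨U, hU⟩ := hunit
  set R : (Icc (0 : ℝ) 1 →ᵇ X) →L[ℝ] (Icc (0 : ℝ) 1 →ᵇ X) :=
    ((U⁻¹ : ((Icc (0 : ℝ) 1 →ᵇ X) →L[ℝ] (Icc (0 : ℝ) 1 →ᵇ X))ˣ) :
      (Icc (0 : ℝ) 1 →ᵇ X) →L[ℝ] (Icc (0 : ℝ) 1 →ᵇ X)) with hR
  have hR1 : ∀ v, R (v - L₀ v) = v := fun v => by
    have := congrArg (fun T => T v) U.inv_mul
    rw [hU] at this
    simpa using this
  have hR2 : ∀ v, R v - L₀ (R v) = v := fun v => by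
    have := congrArg (fun T => T v) U.mul_inv
    rw [hU] at this
    simpa using this
  set C : ℝ := (1 + ‖B‖) * H with hC
  have hC0 : 0 < C := by positivity
  have hHC : H ≤ C := le_mul_of_one_le_left hH0.le (by simp)
  -- A bound for `‖P‖` below, uniform in `ε`.
  set p : ℝ := 1 + ‖R‖ * C with hp
  have hp0 : 0 < p := by positivity
  obtain ⟨ρ, hρ, hlinρ⟩ := hlin (1 / (4 * p * (1 + ‖B‖))) (by positivity)
  set r := min r₁ ρ with hr
  have hr0 : 0 < r := lt_min hr₁ hρ
  -- The first entry makes the defect of `P` at most `1/4`, the second makes `P` injective.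
  set κ : ℝ := min (1 / (4 * p)) (1 / (2 * (1 + 2 * H))) with hκ
  have hκ0 : 0 < κ := by positivity
  obtain ⟨ε₁, hε₁, hlinε⟩ := exists_bvpLinear_oscillating_sub_le B hD hκ0
  obtain ⟨ε₂, hε₂, hres⟩ := exists_oscillatingMap_sub_averagedMap_le B hG z₀
    (κ := r / (2 * p)) (by positivity)
  refine ⟨r, ⟨hr0, min_le_left _ _⟩, min ε₁ ε₂, by positivity, 2 * p, fun ε hε => ?_⟩
  have hlinε := hlinε ε ⟨hε.1, hε.2.trans (min_le_left _ _)⟩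
  have hres := hres ε ⟨hε.1, hε.2.trans (min_le_right _ _)⟩
  rw [hz₀] at hres
  set L := bvpLinear B ⟨fun s => D s (s / ε), hD.continuous_oscillating ε⟩ with hL
  have hLn : ∀ v, ‖L v‖ ≤ C * ‖v‖ := norm_bvpLinear_apply_le B fun s _ => hH _ _
  have hLl : ∀ v (x y : Icc (0 : ℝ) 1), ‖L v x - L v y‖ ≤ H * ‖v‖ * |(x : ℝ) - y| :=
    norm_bvpLinear_sub_le B fun s _ => hH _ _
  have hL₀l : ∀ v (x y : Icc (0 : ℝ) 1), ‖L₀ v x - L₀ v y‖ ≤ H * ‖v‖ * |(x : ℝ) - y| :=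
    norm_bvpLinear_sub_le B fun s _ => hmH _
  -- Since `R (1 - L₀) = 1`, the defect `1 - P (1 - L)` equals `R (L - L₀) L`, where the inner `L`
  -- supplies the Lipschitz bound under which `L - L₀` is small.
  set P : (Icc (0 : ℝ) 1 →ᵇ X) →L[ℝ] (Icc (0 : ℝ) 1 →ᵇ X) := 1 + R.comp L with hP
  have hPv : ∀ v, P v = v + R (L v) := fun v => rfl
  have hPn : ‖P‖ ≤ p := by
    refine ContinuousLinearMap.opNorm_le_bound _ hp0.le fun v => ?_
    rw [hPv, hp, add_mul, one_mul, mul_assoc]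
    exact (norm_add_le _ _).trans (add_le_add le_rfl
      ((R.le_opNorm _).trans (mul_le_mul_of_nonneg_left (hLn v) (norm_nonneg _))))
  have hRC : ‖R‖ * C ≤ p := by simp [hp]
  have hdefect : ∀ v, ‖v - P (v - L v)‖ ≤ 1 / 4 * ‖v‖ := by
    intro v
    have e : v - P (v - L v) = R (L (L v) - L₀ (L v)) := by
      have := hR1 (L v)
      rw [map_sub] at this
      rw [hPv]
      simp only [map_sub]
      rw [← sub_eq_zero] at this ⊢
      rw [← neg_eq_zero, ← this]
      abel
    rw [e]
    have h1 := hlinε (C * ‖v‖) (L v) (hLn v) fun x y => (hLl v x y).trans (by gcongr)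
    calc _ ≤ ‖R‖ * (κ * (C * ‖v‖)) :=
          (R.le_opNorm _).trans (mul_le_mul_of_nonneg_left h1 (norm_nonneg _))
      _ = κ * (‖R‖ * C) * ‖v‖ := by ring
      _ ≤ 1 / (4 * p) * p * ‖v‖ := by
          gcongr
          exact min_le_left _ _
      _ = 1 / 4 * ‖v‖ := by field_simp
  -- Applying `1 - L₀` to `R (L v) = -v` gives `v = L₀ v - L v`. Hence `v` is itself Lipschitz with
  -- constant `2 * H * ‖v‖`, and the smallness of `L₀ - L` yields `‖v‖ ≤ ‖v‖ / 2`.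
  have hinj : ∀ v, P v = 0 → v = 0 := by
    intro v hv
    have hv1 : R (L v) = -v := (neg_eq_of_add_eq_zero_right hv).symm
    have hv2 : v = L₀ v - L v := by
      have := hR2 (L v)
      rw [hv1, map_neg] at this
      rw [← this]
      abel
    have h1 := hlinε ((1 + 2 * H) * ‖v‖) v (le_mul_of_one_le_left (norm_nonneg _) (by linarith))
      fun x y => by
        have e : v x - v y = (L₀ v x - L₀ v y) - (L v x - L v y) := by
          conv_lhs => rw [hv2]
          simp only [BoundedContinuousFunction.sub_apply]
          abel
        rw [e]
        refine (norm_sub_le _ _).trans ((add_le_add (hL₀l v x y) (hLl v x y)).trans ?_)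
        have : 0 ≤ ‖v‖ * |(x : ℝ) - y| := by positivity
        linarith
    rw [norm_sub_rev, ← hL₀, ← hv2, ← mul_assoc] at h1
    have h2 : κ * (1 + 2 * H) ≤ 1 / 2 := by
      calc κ * (1 + 2 * H) ≤ 1 / (2 * (1 + 2 * H)) * (1 + 2 * H) := by
            gcongr
            exact min_le_right _ _
        _ = 1 / 2 := by field_simp
    have h3 := mul_le_mul_of_nonneg_right h2 (norm_nonneg v)
    exact norm_le_zero_iff.1 (by linarith)
  have hT : ∀ z z', ‖z - z₀‖ ≤ r → ‖z' - z₀‖ ≤ r →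
      ‖oscillatingMap B hG ε z - oscillatingMap B hG ε z' - L (z - z')‖
        ≤ 1 / (4 * p) * ‖z - z'‖ := by
    intro z z' hz hz'
    have e : oscillatingMap B hG ε z - oscillatingMap B hG ε z' - L (z - z')
        = bvpSolve B ⟨fun s => G s (s / ε) (extend01 z s) - G s (s / ε) (extend01 z' s)
          - D s (s / ε) (extend01 z s - extend01 z' s),
          (((hG.comp (continuous_extend01 z) (extend01_proj01 z)).continuous_oscillating ε).sub
          ((hG.comp (continuous_extend01 z') (extend01_proj01 z')).continuous_oscillating ε)).sub
          ((hD.continuous_oscillating ε).clm_apply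
            ((continuous_extend01 z).sub (continuous_extend01 z')))⟩ := by
      rw [oscillatingMap, oscillatingMap, hL, bvpLinear_apply, ← bvpSolve_sub, ← bvpSolve_sub]
      rfl
    have hb : ∀ z : Icc (0 : ℝ) 1 →ᵇ X, ‖z - z₀‖ ≤ r → ∀ s,
        ‖extend01 z s - extend01 z₀ s‖ ≤ ρ := fun z hz s =>
      ((z - z₀).norm_coe_le_norm _).trans (hz.trans (min_le_right _ _))
    rw [e]
    refine (norm_bvpSolve_le_of_bound B _ (c := 1 / (4 * p * (1 + ‖B‖)) * ‖z - z'‖)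
      fun s _ => ?_).trans_eq ?_
    · refine (hlinρ s (s / ε) _ _ (hb z hz s) (hb z' hz' s)).trans ?_
      gcongr
      exact (z - z').norm_coe_le_norm _
    · field_simp
  have hsmall : 1 / 4 + ‖P‖ * (1 / (4 * p)) ≤ 1 / 2 := by
    have : ‖P‖ * (1 / (4 * p)) ≤ p * (1 / (4 * p)) := by gcongr
    have e : p * (1 / (4 * p)) = 1 / 4 := by field_simp
    linarith
  have hPres : ‖P‖ * ‖oscillatingMap B hG ε z₀ - z₀‖ ≤ r / 2 := by
    calc ‖P‖ * ‖oscillatingMap B hG ε z₀ - z₀‖ ≤ p * (r / (2 * p)) := by gcongr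
      _ = r / 2 := by field_simp
  obtain ⟨z, h1, h2, h3, h4⟩ :=
    exists_fixedPoint_of_approximate_inverse hr0.le hT hdefect hsmall hinj hPres
  refine ⟨z, h1, h2, h3.trans ?_, h4⟩
  gcongr

end AveragedProblem

/-! ### Extension of the data beyond the unit ball and `[0,1]` -/

/-- The radial retraction onto the closed unit ball. -/
noncomputable def clampBall {n : ℕ} (u : Vec n) : Vec n := (max 1 ‖u‖)⁻¹ • u

theorem continuous_clampBall {n : ℕ} : Continuous (clampBall (n := n)) :=
  ((continuous_const.max continuous_norm).inv₀ fun u => by positivity).smul continuous_id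

theorem norm_clampBall_le {n : ℕ} (u : Vec n) : ‖clampBall u‖ ≤ 1 := by
  rw [clampBall, norm_smul, norm_inv, Real.norm_of_nonneg (by positivity),
    inv_mul_le_one₀ (by positivity)]
  exact le_max_right _ _

theorem clampBall_of_le {n : ℕ} {u : Vec n} (hu : ‖u‖ ≤ 1) : clampBall u = u := by
  rw [clampBall, max_eq_left hu, inv_one, one_smul]

/-- The retraction need not be differentiable on the unit sphere. Derivatives are therefore taken
only at points with `‖u‖ < 1`, where it is locally the identity. -/
theorem eventually_clampBall_eq {n : ℕ} {z : Vec n × Vec n} (hz : ‖z.1‖ < 1) :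
    ∀ᶠ w in 𝓝 z, clampBall w.1 = w.1 := by
  have : ∀ᶠ w : Vec n × Vec n in 𝓝 z, ‖w.1‖ < 1 :=
    (continuous_fst.norm.tendsto z).eventually_lt_const hz
  filter_upwards [this] with w hw using clampBall_of_le hw.le

/-- The assumptions on the flux `a` and the reaction `f`. -/
structure IsAdmissible {n : ℕ} (a f : ℝ → ℝ → Vec n → Vec n → Vec n) (m M : ℝ) : Prop where
  flux_periodic : PeriodicY a
  reaction_periodic : PeriodicY f
  flux_regular : RegularInU a
  reaction_regular : RegularInU f
  pos : 0 < m
  le : m ≤ M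
  monotone : StronglyMonotoneLipschitz a m M

/-- Continuous partial derivatives combine to a strict joint derivative. -/
theorem RegularInU.hasStrictFDerivAt {n : ℕ} {g : ℝ → ℝ → Vec n → Vec n → Vec n}
    (hg : RegularInU g) {x : ℝ} (hx : x ∈ Icc (0 : ℝ) 1) (y : ℝ) (z : Vec n × Vec n) :
    HasStrictFDerivAt (fun w : Vec n × Vec n => g x y w.1 w.2)
      ((fderiv ℝ (fun w => g x y w z.2) z.1).coprod (fderiv ℝ (fun q => g x y z.1 q) z.2)) z := by
  have hcont : Continuous fun w : Vec n × Vec n => ((x, y, w.1, w.2) : ℝ × ℝ × Vec n × Vec n) := by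
    fun_prop
  have hmem : ∀ w : Vec n × Vec n,
      ((x, y, w.1, w.2) : ℝ × ℝ × Vec n × Vec n) ∈ Icc (0 : ℝ) 1 ×ˢ univ := fun w => ⟨hx, trivial⟩
  exact hasStrictFDerivAt_uncurry_coprod (f := fun u p => g x y u p)
    (f₁ := fun u p => fderiv ℝ (fun w => g x y w p) u)
    (f₂ := fun u p => fderiv ℝ (fun q => g x y u q) p)
    (Eventually.of_forall fun v => (hg.2.1 x hx y v.1 v.2).1.hasFDerivAt)
    (Eventually.of_forall fun v => (hg.2.1 x hx y v.1 v.2).2.hasFDerivAt)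
    (hg.2.2.1.comp_continuous hcont hmem).continuousAt
    (hg.2.2.2.comp_continuous hcont hmem).continuousAt

theorem JointlyContinuous.comp_clamp {n : ℕ} {W Λ : Type} [TopologicalSpace W]
    [TopologicalSpace Λ] {h : ℝ → ℝ → Vec n → Vec n → W} (hh : JointlyContinuous h)
    {s y : Λ → ℝ} {u p : Λ → Vec n} (hs : Continuous s) (hy : Continuous y) (hu : Continuous u)
    (hp : Continuous p) :
    Continuous fun l => h (proj01 (s l)) (y l) (clampBall (u l)) (p l) :=
  hh.comp_continuous (f := fun l => ((proj01 (s l), y l, clampBall (u l), p l) :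
      ℝ × ℝ × Vec n × Vec n))
    ((continuous_proj01.comp hs).prodMk
      (hy.prodMk ((continuous_clampBall.comp hu).prodMk hp)))
    fun _ => ⟨proj01_mem _, trivial⟩

/-! ### The first order field for `(u, q)` and its derivative -/

section Reduced

variable {n : ℕ}

/-- The inverse flux `b`, extended to all arguments. -/
noncomputable def redFlux (a : ℝ → ℝ → Vec n → Vec n → Vec n) (x y : ℝ) (z : Vec n × Vec n) :
    Vec n :=
  fluxInv a (proj01 x) y (clampBall z.1) z.2

/-- The right-hand side of the first order system for `(u, q)`, where `q` is the flux. -/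
noncomputable def redField (a f : ℝ → ℝ → Vec n → Vec n → Vec n) (x y : ℝ) (z : Vec n × Vec n) :
    Vec n × Vec n :=
  (redFlux a x y z, f (proj01 x) y (clampBall z.1) (redFlux a x y z))

/-- The partial derivative of a field with respect to `u`, along `redFlux`. -/
noncomputable def partialU (g a : ℝ → ℝ → Vec n → Vec n → Vec n) (x y : ℝ)
    (z : Vec n × Vec n) : Vec n →L[ℝ] Vec n :=
  fderiv ℝ (fun w => g (proj01 x) y w (redFlux a x y z)) (clampBall z.1)

/-- The partial derivative of a field with respect to `u'`, along `redFlux`. -/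
noncomputable def partialP (g a : ℝ → ℝ → Vec n → Vec n → Vec n) (x y : ℝ)
    (z : Vec n × Vec n) : Vec n →L[ℝ] Vec n :=
  fderiv ℝ (fun p => g (proj01 x) y (clampBall z.1) p) (redFlux a x y z)

/-- The derivative of `redFlux`. -/
noncomputable def redFluxDeriv (a : ℝ → ℝ → Vec n → Vec n → Vec n) (x y : ℝ)
    (z : Vec n × Vec n) : Vec n × Vec n →L[ℝ] Vec n :=
  (partialP a a x y z).inverse.comp (ContinuousLinearMap.snd ℝ _ _ -
    (partialU a a x y z).comp (ContinuousLinearMap.fst ℝ _ _))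

/-- The derivative of `redField`. -/
noncomputable def redFieldDeriv (a f : ℝ → ℝ → Vec n → Vec n → Vec n) (x y : ℝ)
    (z : Vec n × Vec n) : Vec n × Vec n →L[ℝ] Vec n × Vec n :=
  (redFluxDeriv a x y z).prod ((partialU f a x y z).comp (ContinuousLinearMap.fst ℝ _ _) +
    (partialP f a x y z).comp (redFluxDeriv a x y z))

variable {a f : ℝ → ℝ → Vec n → Vec n → Vec n} {m M : ℝ}

namespace IsAdmissible

theorem stronglyMonotone (h : IsAdmissible a f m M) (x y : ℝ) (u : Vec n) :
    StronglyMonotone m (a (proj01 x) y (clampBall u)) := fun p q =>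
  (h.monotone _ (proj01_mem x) y _ p q (norm_clampBall_le u)).1

theorem lipschitz (h : IsAdmissible a f m M) (x y : ℝ) (u p q : Vec n) :
    ‖a (proj01 x) y (clampBall u) p - a (proj01 x) y (clampBall u) q‖ ≤ M * ‖p - q‖ :=
  (h.monotone _ (proj01_mem x) y _ p q (norm_clampBall_le u)).2

theorem flux_redFlux (h : IsAdmissible a f m M) (x y : ℝ) (z : Vec n × Vec n) :
    a (proj01 x) y (clampBall z.1) (redFlux a x y z) = z.2 :=
  (h.stronglyMonotone x y z.1).apply_invFun h.pos h.le (h.lipschitz x y z.1) z.2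

theorem redFlux_flux (h : IsAdmissible a f m M) (x y : ℝ) (u p : Vec n) :
    redFlux a x y (u, a (proj01 x) y (clampBall u) p) = p :=
  Function.leftInverse_invFun ((h.stronglyMonotone x y u).injective h.pos) p

theorem redFlux_stronglyMonotone (h : IsAdmissible a f m M) (x y : ℝ) (u : Vec n) :
    StronglyMonotone (m / M ^ 2) fun q => redFlux a x y (u, q) :=
  (h.stronglyMonotone x y u).invFun h.pos h.le (h.lipschitz x y u)

theorem norm_redFlux_sub_le (h : IsAdmissible a f m M) (x y : ℝ) (u p q : Vec n) :
    ‖redFlux a x y (u, p) - redFlux a x y (u, q)‖ ≤ m⁻¹ * ‖p - q‖ :=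
  (h.stronglyMonotone x y u).norm_invFun_sub_le h.pos h.le (h.lipschitz x y u) p q

theorem continuous_redFlux (h : IsAdmissible a f m M) :
    Continuous fun w : ℝ × ℝ × Vec n × Vec n => redFlux a w.1 w.2.1 w.2.2 := by
  have := continuous_invFun_of_stronglyMonotone (Λ := ℝ × ℝ × Vec n) h.pos h.le
    (F := fun l => a (proj01 l.1) l.2.1 (clampBall l.2.2))
    (fun _ => h.stronglyMonotone _ _ _) (fun _ => h.lipschitz _ _ _)
    (fun p => h.flux_regular.1.comp_clamp (by fun_prop) (by fun_prop) (by fun_prop) (by fun_prop))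
  exact this.comp (f := fun w : ℝ × ℝ × Vec n × Vec n =>
    (((w.1, w.2.1, w.2.2.1), w.2.2.2) : (ℝ × ℝ × Vec n) × Vec n)) (by fun_prop)

theorem isCellFunction_redFlux (h : IsAdmissible a f m M) : IsCellFunction (redFlux a) where
  continuous := h.continuous_redFlux
  proj x y z := by simp [redFlux]
  periodic x y z := by
    have : a (proj01 x) (y + 1) (clampBall z.1) = a (proj01 x) y (clampBall z.1) :=
      funext fun p => h.flux_periodic _ (proj01_mem x) _ _ _
    simp only [redFlux, fluxInv, this]

theorem isCellFunction_redField (h : IsAdmissible a f m M) : IsCellFunction (redField a f) where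
  continuous := h.continuous_redFlux.prodMk
    (h.reaction_regular.1.comp_clamp (by fun_prop) (by fun_prop) (by fun_prop)
      h.continuous_redFlux)
  proj x y z := by simp [redField, h.isCellFunction_redFlux.proj]
  periodic x y z := by
    simp only [redField, h.isCellFunction_redFlux.periodic,
      h.reaction_periodic _ (proj01_mem x)]

theorem continuous_partialU (h : IsAdmissible a f m M) {g : ℝ → ℝ → Vec n → Vec n → Vec n}
    (hg : RegularInU g) :
    Continuous fun w : ℝ × ℝ × Vec n × Vec n => partialU g a w.1 w.2.1 w.2.2 :=
  hg.2.2.1.comp_clamp (by fun_prop) (by fun_prop) (by fun_prop) h.continuous_redFlux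

theorem continuous_partialP (h : IsAdmissible a f m M) {g : ℝ → ℝ → Vec n → Vec n → Vec n}
    (hg : RegularInU g) :
    Continuous fun w : ℝ × ℝ × Vec n × Vec n => partialP g a w.1 w.2.1 w.2.2 :=
  hg.2.2.2.comp_clamp (by fun_prop) (by fun_prop) (by fun_prop) h.continuous_redFlux

theorem exists_equiv_partialP (h : IsAdmissible a f m M) (x y : ℝ) (z : Vec n × Vec n) :
    ∃ e : Vec n ≃L[ℝ] Vec n, (e : Vec n →L[ℝ] Vec n) = partialP a a x y z :=
  exists_continuousLinearEquiv_of_coercive h.pos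
    ((h.stronglyMonotone x y z.1).coercive_of_hasFDerivAt
      (h.flux_regular.2.1 _ (proj01_mem x) y _ _).2.hasFDerivAt)

theorem continuous_redFluxDeriv (h : IsAdmissible a f m M) :
    Continuous fun w : ℝ × ℝ × Vec n × Vec n => redFluxDeriv a w.1 w.2.1 w.2.2 := by
  have hinv : Continuous fun w : ℝ × ℝ × Vec n × Vec n =>
      (partialP a a w.1 w.2.1 w.2.2).inverse := by
    rw [continuous_iff_continuousAt]
    intro w
    obtain ⟨e, he⟩ := h.exists_equiv_partialP w.1 w.2.1 w.2.2
    have h1 : ContinuousAt (ContinuousLinearMap.inverse : (Vec n →L[ℝ] Vec n) → _)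
        (partialP a a w.1 w.2.1 w.2.2) := by
      rw [← he]
      exact (contDiffAt_map_inverse (n := 0) e).continuousAt
    exact ContinuousAt.comp (g := ContinuousLinearMap.inverse)
      (f := fun w : ℝ × ℝ × Vec n × Vec n => partialP a a w.1 w.2.1 w.2.2) h1
      (h.continuous_partialP h.flux_regular).continuousAt
  exact hinv.clm_comp (continuous_const.sub
    ((h.continuous_partialU h.flux_regular).clm_comp continuous_const))

/-- The parametric inverse rule, with `u` as parameter; strong monotonicity makes `∂_{u'} a`
invertible. -/
theorem hasStrictFDerivAt_redFlux (h : IsAdmissible a f m M) (x y : ℝ) {z : Vec n × Vec n}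
    (hz : ‖z.1‖ < 1) : HasStrictFDerivAt (redFlux a x y) (redFluxDeriv a x y z) z := by
  obtain ⟨e, he⟩ := h.exists_equiv_partialP x y z
  have hcl : clampBall z.1 = z.1 := clampBall_of_le hz.le
  have hF := h.flux_regular.hasStrictFDerivAt (proj01_mem x) y (z.1, redFlux a x y z)
  have hF' : HasStrictFDerivAt
      (fun w : Vec n × Vec n => a (proj01 x) y (clampBall w.1) w.2)
      ((partialU a a x y z).coprod (partialP a a x y z)) (z.1, redFlux a x y (z.1, z.2)) := by
    have : (partialU a a x y z).coprod (partialP a a x y z)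
        = (fderiv ℝ (fun w => a (proj01 x) y w (redFlux a x y z)) z.1).coprod
          (fderiv ℝ (fun q => a (proj01 x) y z.1 q) (redFlux a x y z)) := by
      simp only [partialU, partialP, hcl]
    rw [this]
    refine hF.congr_of_eventuallyEq ?_
    filter_upwards [eventually_clampBall_eq (z := (z.1, redFlux a x y z)) hz] with w hw
    rw [hw]
  have hc : Continuous (redFlux a x y) :=
    h.continuous_redFlux.comp (continuous_const.prodMk (continuous_const.prodMk continuous_id))
  have := hasStrictFDerivAt_of_parametric_inverse (u := z.1) (q := z.2) (e := e)
    hc.continuousAt hF' (fun w => h.flux_redFlux x y w) (by rw [he]; simp)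
  have hd : redFluxDeriv a x y z = (e.symm : Vec n →L[ℝ] Vec n).comp
      (ContinuousLinearMap.snd ℝ _ _ - (((partialU a a x y z).coprod (partialP a a x y z)).comp
        (ContinuousLinearMap.inl ℝ _ _)).comp (ContinuousLinearMap.fst ℝ _ _)) := by
    simp only [redFluxDeriv, ← he, ContinuousLinearMap.inverse_equiv,
      ContinuousLinearMap.coprod_comp_inl]
  rw [hd]
  exact this

theorem continuous_redFieldDeriv (h : IsAdmissible a f m M) :
    Continuous fun w : ℝ × ℝ × Vec n × Vec n => redFieldDeriv a f w.1 w.2.1 w.2.2 := by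
  have h1 := h.continuous_redFluxDeriv
  have h2 : Continuous fun w : ℝ × ℝ × Vec n × Vec n =>
      (partialU f a w.1 w.2.1 w.2.2).comp (ContinuousLinearMap.fst ℝ (Vec n) (Vec n)) +
        (partialP f a w.1 w.2.1 w.2.2).comp (redFluxDeriv a w.1 w.2.1 w.2.2) :=
    ((h.continuous_partialU h.reaction_regular).clm_comp continuous_const).add
      ((h.continuous_partialP h.reaction_regular).clm_comp h1)
  have := (ContinuousLinearMap.prodₗᵢ ℝ : ((Vec n × Vec n →L[ℝ] Vec n) ×
    (Vec n × Vec n →L[ℝ] Vec n)) ≃ₗᵢ[ℝ] _).continuous.comp (h1.prodMk h2)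
  exact this

theorem hasStrictFDerivAt_redField (h : IsAdmissible a f m M) (x y : ℝ) {z : Vec n × Vec n}
    (hz : ‖z.1‖ < 1) : HasStrictFDerivAt (redField a f x y) (redFieldDeriv a f x y z) z := by
  have hb := h.hasStrictFDerivAt_redFlux x y hz
  have hcl : clampBall z.1 = z.1 := clampBall_of_le hz.le
  have hf := h.reaction_regular.hasStrictFDerivAt (proj01_mem x) y (z.1, redFlux a x y z)
  have hcomp := hf.comp z (f := fun w => (w.1, redFlux a x y w)) (hasStrictFDerivAt_fst.prodMk hb)
  have hcomp' : HasStrictFDerivAt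
      (fun w => f (proj01 x) y (clampBall w.1) (redFlux a x y w))
      ((partialU f a x y z).comp (ContinuousLinearMap.fst ℝ _ _) +
        (partialP f a x y z).comp (redFluxDeriv a x y z)) z := by
    have e : (partialU f a x y z).comp (ContinuousLinearMap.fst ℝ (Vec n) (Vec n)) +
        (partialP f a x y z).comp (redFluxDeriv a x y z)
        = ((fderiv ℝ (fun w => f (proj01 x) y w (redFlux a x y z)) z.1).coprod
          (fderiv ℝ (fun q => f (proj01 x) y z.1 q) (redFlux a x y z))).comp
          ((ContinuousLinearMap.fst ℝ (Vec n) (Vec n)).prod (redFluxDeriv a x y z)) := by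
      ext v <;> simp [partialU, partialP, hcl]
    rw [e]
    refine hcomp.congr_of_eventuallyEq ?_
    filter_upwards [eventually_clampBall_eq hz] with w hw
    simp [hw]
  exact hb.prodMk hcomp'

end IsAdmissible

end Reduced

/-! ### Linearization, uniform in the fast variable -/

section Linearization

open BoundedContinuousFunction

variable {X : Type*} [NormedAddCommGroup X] [NormedSpace ℝ X]

/-- Mean value inequality on a ball around `z₀(x)`, where the derivative stays within `κ` of its
value at the centre. Compactness of the graph of `z₀` and periodicity make the radius independent of
`x` and `y`, hence later of `ε`. -/
theorem IsCellFunction.exists_linearization_bound {G : ℝ → ℝ → X → X} {G' : ℝ → ℝ → X → X →L[ℝ] X}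
    (hG' : IsCellFunction G') {z₀ : Icc (0 : ℝ) 1 →ᵇ X} {r₀ : ℝ} (hr₀ : 0 < r₀)
    (hd : ∀ x y z, ‖z - extend01 z₀ x‖ < r₀ → HasFDerivAt (G x y) (G' x y z) z)
    {κ : ℝ} (hκ : 0 < κ) :
    ∃ r > 0, ∀ x y ζ ζ', ‖ζ - extend01 z₀ x‖ ≤ r → ‖ζ' - extend01 z₀ x‖ ≤ r →
      ‖G x y ζ - G x y ζ' - G' x y (extend01 z₀ x) (ζ - ζ')‖ ≤ κ * ‖ζ - ζ'‖ := by
  obtain ⟨δ, hδ, h⟩ := exists_uniform_near_graph (continuous_extend01 z₀) (extend01_proj01 z₀)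
    hG'.proj hG'.periodic (fun x y => hG'.continuous.continuousAt) hκ
  refine ⟨min (r₀ / 2) (δ / 2), by positivity, fun x y ζ ζ' hζ hζ' => ?_⟩
  have hlt : ∀ z ∈ Metric.closedBall (extend01 z₀ x) (min (r₀ / 2) (δ / 2)),
      ‖z - extend01 z₀ x‖ < r₀ ∧ ‖z - extend01 z₀ x‖ < δ := by
    intro z hz
    rw [mem_closedBall_iff_norm] at hz
    exact ⟨by linarith [hz.trans (min_le_left _ _)], by linarith [hz.trans (min_le_right _ _)]⟩
  exact Convex.norm_image_sub_le_of_norm_hasFDerivWithin_le' (𝕜 := ℝ)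
    (s := Metric.closedBall (extend01 z₀ x) (min (r₀ / 2) (δ / 2)))
    (fun z hz => (hd x y z (hlt z hz).1).hasFDerivWithinAt)
    (fun z hz => (h x y z (by rw [dist_eq_norm]; exact (hlt z hz).2)).le)
    (convex_closedBall _ _) (mem_closedBall_iff_norm.2 hζ') (mem_closedBall_iff_norm.2 hζ)

theorem cellMean_sub {h k : ℝ → X} (hh : Continuous h) (hk : Continuous k) :
    cellMean (fun y => h y - k y) = cellMean h - cellMean k :=
  intervalIntegral.integral_sub (hh.intervalIntegrable _ _) (hk.intervalIntegrable _ _)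

theorem ContinuousLinearMap.map_cellMean [CompleteSpace X] {Y : Type*} [NormedAddCommGroup Y]
    [NormedSpace ℝ Y] [CompleteSpace Y] (L : X →L[ℝ] Y) {h : ℝ → X} (hh : Continuous h) :
    L (cellMean h) = cellMean fun y => L (h y) :=
  (L.intervalIntegral_comp_comm (hh.intervalIntegrable _ _)).symm

theorem cellMean_clm_apply [CompleteSpace X] {A : ℝ → X →L[ℝ] X} (hA : Continuous A) (v : X) :
    cellMean A v = cellMean fun y => A y v :=
  ContinuousLinearMap.intervalIntegral_apply (hA.intervalIntegrable _ _) v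

/-- The remainder estimate is uniform in `y`, so it survives integration over the cell. -/
theorem hasStrictFDerivAt_cellMean [CompleteSpace X] {G : ℝ → X → X} {A : ℝ → X →L[ℝ] X} {ζ : X}
    (hG : ∀ z, Continuous fun y => G y z) (hA : Continuous A)
    (hlin : ∀ κ > 0, ∃ r > 0, ∀ y z z', ‖z - ζ‖ ≤ r → ‖z' - ζ‖ ≤ r →
      ‖G y z - G y z' - A y (z - z')‖ ≤ κ * ‖z - z'‖) :
    HasStrictFDerivAt (fun z => cellMean fun y => G y z) (cellMean A) ζ := by
  rw [hasStrictFDerivAt_iff_isLittleO, Asymptotics.isLittleO_iff]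
  intro κ hκ
  obtain ⟨r, hr, h⟩ := hlin κ hκ
  have hnear : ∀ᶠ z in 𝓝 ζ, ‖z - ζ‖ ≤ r := by
    filter_upwards [Metric.closedBall_mem_nhds ζ hr] with z hz using mem_closedBall_iff_norm.1 hz
  filter_upwards [hnear.prod_nhds hnear] with w hw
  have hsub : Continuous fun y => G y w.1 - G y w.2 := (hG _).sub (hG _)
  rw [cellMean_clm_apply hA, ← cellMean_sub (hG _) (hG _),
    ← cellMean_sub hsub (hA.clm_apply continuous_const)]
  exact norm_cellMean_le fun y => h y _ _ hw.1 hw.2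

end Linearization

/-- The two separate partial derivatives add up to the joint one. Agreement near the base point
suffices, so `G` may be replaced by its extension `F`. -/
theorem linearize_eq_of_hasFDerivAt {n : ℕ} {G : ℝ → Vec n → Vec n → Vec n} {u : ℝ → Vec n} {x : ℝ}
    {F : Vec n × Vec n → Vec n} {T : Vec n × Vec n →L[ℝ] Vec n}
    (hF : HasFDerivAt F T (u x, deriv01 u x))
    (heq : ∀ᶠ w in 𝓝 (u x, deriv01 u x), F w = G x w.1 w.2) (v p : Vec n) :
    linearize G u x v p = T (v, p) := by
  have hG : HasFDerivAt (fun w : Vec n × Vec n => G x w.1 w.2) T (u x, deriv01 u x) :=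
    hF.congr_of_eventuallyEq (heq.mono fun w hw => hw.symm)
  have h1 := hG.comp (u x) (f := fun w => (w, deriv01 u x))
    ((hasFDerivAt_id (u x)).prodMk (hasFDerivAt_const _ _))
  have h2 := hG.comp (deriv01 u x) (f := fun q => (u x, q))
    ((hasFDerivAt_const _ _).prodMk (hasFDerivAt_id (deriv01 u x)))
  have e1 := h1.fderiv
  have e2 := h2.fderiv
  simp only [Function.comp_def] at e1 e2
  rw [linearize, e1, e2]
  simp [← map_add]

/-! ### The averaged field and the homogenized flux -/

section Homogenized

variable {n : ℕ}

/-- The inverse `b₀` of the homogenized flux, extended to all arguments. -/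
noncomputable def avgFlux (a : ℝ → ℝ → Vec n → Vec n → Vec n) (x : ℝ) (z : Vec n × Vec n) :
    Vec n :=
  cellMean fun y => redFlux a x y z

/-- The right-hand side of the averaged first order system. -/
noncomputable def avgField (a f : ℝ → ℝ → Vec n → Vec n → Vec n) (x : ℝ) (z : Vec n × Vec n) :
    Vec n × Vec n :=
  cellMean fun y => redField a f x y z

/-- The homogenized flux `a₀`, extended to all arguments. -/
noncomputable def extHomFlux (a : ℝ → ℝ → Vec n → Vec n → Vec n) (x : ℝ) (w : Vec n × Vec n) :
    Vec n :=
  homFlux a (proj01 x) (clampBall w.1) w.2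

variable {a f : ℝ → ℝ → Vec n → Vec n → Vec n} {m M : ℝ}

namespace IsAdmissible

theorem continuous_redFlux_cell (h : IsAdmissible a f m M) (x : ℝ) (z : Vec n × Vec n) :
    Continuous fun y => redFlux a x y z :=
  h.continuous_redFlux.comp (continuous_const.prodMk (continuous_id.prodMk continuous_const))

theorem continuous_redField_cell (h : IsAdmissible a f m M) (x : ℝ) (z : Vec n × Vec n) :
    Continuous fun y => redField a f x y z :=
  h.isCellFunction_redField.continuous.comp
    (continuous_const.prodMk (continuous_id.prodMk continuous_const))

theorem avgField_fst (h : IsAdmissible a f m M) (x : ℝ) (z : Vec n × Vec n) :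
    (avgField a f x z).1 = avgFlux a x z :=
  (ContinuousLinearMap.fst ℝ (Vec n) (Vec n)).map_cellMean (h.continuous_redField_cell x z)

theorem avgField_snd (h : IsAdmissible a f m M) (x : ℝ) (z : Vec n × Vec n) :
    (avgField a f x z).2 = cellMean fun y => f (proj01 x) y (clampBall z.1) (redFlux a x y z) :=
  (ContinuousLinearMap.snd ℝ (Vec n) (Vec n)).map_cellMean (h.continuous_redField_cell x z)

theorem continuous_avgFlux (h : IsAdmissible a f m M) :
    Continuous fun w : ℝ × Vec n × Vec n => avgFlux a w.1 w.2 :=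
  continuous_cellMean (h := fun (w : ℝ × Vec n × Vec n) y => redFlux a w.1 y w.2)
    (h.continuous_redFlux.comp (f := fun v : (ℝ × Vec n × Vec n) × ℝ => (v.1.1, v.2, v.1.2))
      (by fun_prop))

theorem continuous_avgField (h : IsAdmissible a f m M) :
    Continuous fun w : ℝ × Vec n × Vec n => avgField a f w.1 w.2 :=
  continuous_cellMean (h := fun (w : ℝ × Vec n × Vec n) y => redField a f w.1 y w.2)
    (h.isCellFunction_redField.continuous.comp
      (f := fun v : (ℝ × Vec n × Vec n) × ℝ => (v.1.1, v.2, v.1.2)) (by fun_prop))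

theorem avgFlux_stronglyMonotone (h : IsAdmissible a f m M) (x : ℝ) (u : Vec n) :
    StronglyMonotone (m / M ^ 2) fun q => avgFlux a x (u, q) := by
  intro p q
  have hc : ∀ q, Continuous fun y => redFlux a x y (u, q) :=
    fun q => h.continuous_redFlux_cell x (u, q)
  have e : inner ℝ (avgFlux a x (u, p) - avgFlux a x (u, q)) (p - q)
      = ∫ y in (0 : ℝ)..1, inner ℝ (redFlux a x y (u, p) - redFlux a x y (u, q)) (p - q) := by
    have hsub : Continuous fun y => redFlux a x y (u, p) - redFlux a x y (u, q) :=
      (hc p).sub (hc q)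
    rw [avgFlux, avgFlux, ← cellMean_sub (hc p) (hc q), real_inner_comm,
      ← innerSL_apply_apply ℝ, ContinuousLinearMap.map_cellMean _ hsub, cellMean]
    simp only [innerSL_apply_apply, real_inner_comm]
  rw [e]
  have hmono := intervalIntegral.integral_mono_on (a := (0 : ℝ)) (b := 1) (μ := MeasureTheory.volume)
    zero_le_one
    (continuous_const (y := m / M ^ 2 * ‖p - q‖ ^ 2).intervalIntegrable _ _)
    ((((hc p).sub (hc q)).inner (continuous_const (y := p - q))).intervalIntegrable _ _)
    (fun y _ => h.redFlux_stronglyMonotone x y u p q)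
  simpa using hmono

theorem norm_avgFlux_sub_le (h : IsAdmissible a f m M) (x : ℝ) (u p q : Vec n) :
    ‖avgFlux a x (u, p) - avgFlux a x (u, q)‖ ≤ m⁻¹ * ‖p - q‖ := by
  rw [avgFlux, avgFlux, ← cellMean_sub (h.continuous_redFlux_cell x _)
    (h.continuous_redFlux_cell x _)]
  exact norm_cellMean_le fun y => h.norm_redFlux_sub_le x y u p q

theorem avg_pos (h : IsAdmissible a f m M) : 0 < m / M ^ 2 :=
  div_pos h.pos (pow_pos (h.pos.trans_le h.le) 2)

/-- The order of the monotonicity and Lipschitz constants needed to invert the averaged map. -/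
theorem avg_le (h : IsAdmissible a f m M) : m / M ^ 2 ≤ m⁻¹ := by
  have hm := h.pos
  have hM : 0 < M := h.pos.trans_le h.le
  rw [div_le_iff₀ (by positivity), inv_mul_eq_div, le_div_iff₀ hm]
  nlinarith [h.le]

/-- At projected and clamped arguments `homFluxInv` unfolds to `avgFlux`, so the `invFun` in
`homFlux` is a genuine inverse of a strongly monotone map. -/
theorem avgFlux_extHomFlux (h : IsAdmissible a f m M) (x : ℝ) (w : Vec n × Vec n) :
    avgFlux a x (w.1, extHomFlux a x w) = w.2 :=
  (h.avgFlux_stronglyMonotone x w.1).apply_invFun h.avg_pos h.avg_le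
    (h.norm_avgFlux_sub_le x w.1) w.2

theorem extHomFlux_avgFlux (h : IsAdmissible a f m M) (x : ℝ) (u q : Vec n) :
    extHomFlux a x (u, avgFlux a x (u, q)) = q :=
  Function.leftInverse_invFun ((h.avgFlux_stronglyMonotone x u).injective h.avg_pos) q

theorem continuous_extHomFlux (h : IsAdmissible a f m M) :
    Continuous fun w : ℝ × Vec n × Vec n => extHomFlux a w.1 w.2 := by
  have := continuous_invFun_of_stronglyMonotone (Λ := ℝ × Vec n) h.avg_pos h.avg_le
    (F := fun l q => avgFlux a l.1 (l.2, q))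
    (fun _ => h.avgFlux_stronglyMonotone _ _) (fun _ => h.norm_avgFlux_sub_le _ _)
    (fun p => h.continuous_avgFlux.comp (f := fun l : ℝ × Vec n => (l.1, l.2, p)) (by fun_prop))
  exact this.comp (f := fun w : ℝ × Vec n × Vec n =>
    (((w.1, w.2.1), w.2.2) : (ℝ × Vec n) × Vec n)) (by fun_prop)

/-- The flux `a₀(x, u, p)` is independent of `y`, so `f₀` is the mean of `f` along `b` at a fixed
flux, which is how `avgField` is built. -/
theorem homReaction_eq (h : IsAdmissible a f m M) (x : ℝ) (w : Vec n × Vec n) :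
    homReaction a f (proj01 x) (clampBall w.1) w.2
      = (avgField a f x (w.1, extHomFlux a x w)).2 := by
  rw [h.avgField_snd]
  rfl

theorem isCellFunction_redFieldDeriv (h : IsAdmissible a f m M) :
    IsCellFunction (redFieldDeriv a f) where
  continuous := h.continuous_redFieldDeriv
  proj x y z := by
    simp [redFieldDeriv, redFluxDeriv, partialU, partialP, h.isCellFunction_redFlux.proj]
  periodic x y z := by
    have ea : a (proj01 x) (y + 1) = a (proj01 x) y :=
      funext fun u => funext fun p => h.flux_periodic _ (proj01_mem x) _ _ _
    have ef : f (proj01 x) (y + 1) = f (proj01 x) y :=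
      funext fun u => funext fun p => h.reaction_periodic _ (proj01_mem x) _ _ _
    simp only [redFieldDeriv, redFluxDeriv, partialU, partialP, h.isCellFunction_redFlux.periodic,
      ea, ef]

variable {z₀ : BoundedContinuousFunction (Icc (0 : ℝ) 1) (Vec n × Vec n)}

/-- The coefficient of the oscillating linearized first order system. -/
theorem isCellCoefficient_redFieldDeriv (h : IsAdmissible a f m M)
    (z₀ : BoundedContinuousFunction (Icc (0 : ℝ) 1) (Vec n × Vec n)) :
    IsCellCoefficient fun x y => redFieldDeriv a f x y (extend01 z₀ x) :=
  h.isCellFunction_redFieldDeriv.comp (continuous_extend01 z₀) (extend01_proj01 z₀)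

theorem exists_linearization_bound (h : IsAdmissible a f m M) {ρ : ℝ} (hρ : ρ < 1)
    (hz₀ : ∀ x, ‖(extend01 z₀ x).1‖ ≤ ρ) {κ : ℝ} (hκ : 0 < κ) :
    ∃ r > 0, ∀ x y ζ ζ', ‖ζ - extend01 z₀ x‖ ≤ r → ‖ζ' - extend01 z₀ x‖ ≤ r →
      ‖redField a f x y ζ - redField a f x y ζ'
        - redFieldDeriv a f x y (extend01 z₀ x) (ζ - ζ')‖ ≤ κ * ‖ζ - ζ'‖ := by
  refine h.isCellFunction_redFieldDeriv.exists_linearization_bound (r₀ := 1 - ρ) (by linarith)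
    (fun x y z hz => (h.hasStrictFDerivAt_redField x y ?_).hasFDerivAt) hκ
  calc ‖z.1‖ = ‖(z - extend01 z₀ x).1 + (extend01 z₀ x).1‖ := by simp
    _ ≤ ‖z - extend01 z₀ x‖ + ρ :=
      (norm_add_le _ _).trans (add_le_add (norm_fst_le _) (hz₀ x))
    _ < 1 := by linarith

theorem hasStrictFDerivAt_avgField (h : IsAdmissible a f m M) {ρ : ℝ} (hρ : ρ < 1)
    (hz₀ : ∀ x, ‖(extend01 z₀ x).1‖ ≤ ρ) (x : ℝ) :
    HasStrictFDerivAt (avgField a f x)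
      (cellMean fun y => redFieldDeriv a f x y (extend01 z₀ x)) (extend01 z₀ x) := by
  refine hasStrictFDerivAt_cellMean (fun z => h.continuous_redField_cell x z)
    ((h.isCellCoefficient_redFieldDeriv z₀).continuous.comp
      (continuous_const.prodMk continuous_id)) fun κ hκ => ?_
  obtain ⟨r, hr, hb⟩ := h.exists_linearization_bound hρ hz₀ hκ
  exact ⟨r, hr, fun y z z' hz hz' => hb x y z z' hz hz'⟩

/-- `T` is the derivative of `a₀`. The identity for `T` says that, at fixed `v`, it inverts the
linearized `b₀`; this is the only information on it that the nondegeneracy argument uses. -/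
theorem exists_hasStrictFDerivAt_extHomFlux (h : IsAdmissible a f m M) {x : ℝ}
    {z : Vec n × Vec n} {A : Vec n × Vec n →L[ℝ] Vec n × Vec n}
    (hA : HasStrictFDerivAt (avgField a f x) A z) :
    ∃ T : Vec n × Vec n →L[ℝ] Vec n,
      HasStrictFDerivAt (extHomFlux a x) T (z.1, avgFlux a x z) ∧
      ∀ v σ, T (v, (A (v, σ)).1) = σ := by
  have hF : HasStrictFDerivAt (avgFlux a x) ((ContinuousLinearMap.fst ℝ _ _).comp A) z := by
    have : avgFlux a x = fun z => (avgField a f x z).1 :=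
      funext fun z => (h.avgField_fst x z).symm
    rw [this]
    exact hA.fst
  have hFq : HasFDerivAt (fun q => avgFlux a x (z.1, q))
      (((ContinuousLinearMap.fst ℝ _ _).comp A).comp (ContinuousLinearMap.inr ℝ _ _)) z.2 :=
    HasFDerivAt.comp (g := avgFlux a x) (f := fun q => (z.1, q)) z.2 hF.hasFDerivAt
      (hasFDerivAt_prodMk_right z.1 z.2)
  obtain ⟨e, he⟩ := exists_continuousLinearEquiv_of_coercive h.avg_pos
    (A := ((ContinuousLinearMap.fst ℝ _ _).comp A).comp (ContinuousLinearMap.inr ℝ _ _))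
    ((h.avgFlux_stronglyMonotone x z.1).coercive_of_hasFDerivAt hFq)
  have hc : Continuous (extHomFlux a x) :=
    h.continuous_extHomFlux.comp (continuous_const.prodMk continuous_id)
  have hS : extHomFlux a x (z.1, avgFlux a x z) = z.2 := h.extHomFlux_avgFlux x z.1 z.2
  refine ⟨_, hasStrictFDerivAt_of_parametric_inverse (e := e) hc.continuousAt
    (by rw [hS]; exact hF) (fun w => h.avgFlux_extHomFlux x w) he, fun v σ => ?_⟩
  have h1 : (A (v, σ)).1 = (A (v, 0)).1 + e σ := by
    have : e σ = (A (0, σ)).1 := by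
      simpa using congrArg (fun B : Vec n →L[ℝ] Vec n => B σ) he
    rw [this, ← Prod.fst_add, ← map_add]
    simp
  simp [h1]

end IsAdmissible

end Homogenized

/-! ### Weak solutions as solutions of integral equations -/

section WeakSolutions

open BoundedContinuousFunction

variable {n : ℕ}

/-- The projection of `(u, q)` onto `(0, q)`, which encodes the conditions `u(0) = 0`, `q(1) = 0`. -/
noncomputable def fluxProj (n : ℕ) : Vec n × Vec n →L[ℝ] Vec n × Vec n :=
  (0 : Vec n × Vec n →L[ℝ] Vec n).prod (ContinuousLinearMap.snd ℝ (Vec n) (Vec n))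

theorem intervalIntegral_fst {h : ℝ → Vec n × Vec n} (hh : Continuous h) (a b : ℝ) :
    (∫ s in a..b, h s).1 = ∫ s in a..b, (h s).1 :=
  ((ContinuousLinearMap.fst ℝ (Vec n) (Vec n)).intervalIntegral_comp_comm
    (hh.intervalIntegrable a b)).symm

theorem intervalIntegral_snd {h : ℝ → Vec n × Vec n} (hh : Continuous h) (a b : ℝ) :
    (∫ s in a..b, h s).2 = ∫ s in a..b, (h s).2 :=
  ((ContinuousLinearMap.snd ℝ (Vec n) (Vec n)).intervalIntegral_comp_comm
    (hh.intervalIntegrable a b)).symm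

/-- Subtracting the full integral of the second component moves its base point from `0` to `1`,
which encodes `q(1) = 0`. -/
theorem bvpIntegral_fluxProj {h : ℝ → Vec n × Vec n} (hh : Continuous h) (x : ℝ) :
    bvpIntegral (fluxProj n) h x
      = (∫ s in (0 : ℝ)..x, (h s).1, ∫ s in (1 : ℝ)..x, (h s).2) := by
  have hi2 : ∀ a b, IntervalIntegrable (fun s => (h s).2) MeasureTheory.volume a b := fun a b =>
    hh.snd.intervalIntegrable a b
  ext1
  · simp [bvpIntegral, fluxProj, intervalIntegral_fst hh]
  · simp only [bvpIntegral, fluxProj, Prod.snd_sub, intervalIntegral_snd hh, ContinuousLinearMap.prod_apply,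
      ContinuousLinearMap.coe_snd']
    exact intervalIntegral.integral_interval_sub_left (hi2 _ _) (hi2 _ _)

theorem continuousOn_deriv01 {u : ℝ → Vec n} (hu : ContDiffOn ℝ 1 u (Icc 0 1)) :
    ContinuousOn (deriv01 u) (Icc 0 1) :=
  hu.continuousOn_derivWithin (uniqueDiffOn_Icc zero_lt_one) le_rfl

theorem continuous_comp_proj01 {Y : Type*} [TopologicalSpace Y] {v : ℝ → Y}
    (hv : ContinuousOn v (Icc 0 1)) : Continuous fun x => v (proj01 x) :=
  hv.comp_continuous continuous_proj01 proj01_mem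

/-- The integrand is the derivative of `⟨σ, φ⟩`, whose boundary values vanish through `σ` at `1` and
through `φ` at `0`. -/
theorem integral_inner_deriv01_add_eq_zero {σ β φ : ℝ → Vec n} (hσ : ∀ x, HasDerivAt σ (β x) x)
    (hβ : Continuous β) (hσ1 : σ 1 = 0) (hφ : ContDiffOn ℝ 1 φ (Icc 0 1)) (hφ0 : φ 0 = 0) :
    ∫ x in (0 : ℝ)..1, (inner ℝ (σ x) (deriv01 φ x) + inner ℝ (β x) (φ x)) = 0 := by
  have hσc : Continuous σ := continuous_iff_continuousAt.2 fun x => (hσ x).continuousAt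
  have hφc := hφ.continuousOn
  have h := intervalIntegral.integral_eq_sub_of_hasDerivAt_of_le (a := (0 : ℝ)) (b := 1)
    (f := fun x => inner ℝ (σ x) (φ x))
    (f' := fun x => inner ℝ (σ x) (deriv01 φ x) + inner ℝ (β x) (φ x)) zero_le_one
    (hσc.continuousOn.inner hφc)
    (fun x hx => by
      have hd : HasDerivAt φ (deriv01 φ x) x :=
        ((hφ.differentiableOn one_ne_zero x (Ioo_subset_Icc_self hx)).hasDerivWithinAt).hasDerivAt
          (Icc_mem_nhds hx.1 hx.2)
      exact (hσ x).inner ℝ hd)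
    (((hσc.continuousOn.inner (continuousOn_deriv01 hφ)).add
      (hβ.continuousOn.inner hφc)).intervalIntegrable_of_Icc zero_le_one)
  rw [h, hσ1, hφ0]
  simp

theorem contDiff_primitive {h : ℝ → Vec n} (hh : Continuous h) (a : ℝ) :
    ContDiff ℝ 1 fun x => ∫ s in a..x, h s := by
  have hd : ∀ x, HasDerivAt (fun x => ∫ s in a..x, h s) (h x) x := fun x =>
    (hh.integral_hasStrictDerivAt a x).hasDerivAt
  rw [contDiff_one_iff_deriv]
  refine ⟨fun x => (hd x).differentiableAt, ?_⟩
  rwa [show deriv (fun x => ∫ s in a..x, h s) = h from funext fun x => (hd x).deriv]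

theorem deriv01_of_hasDerivAt {u v : ℝ → Vec n} {v' : Vec n} {x : ℝ} (hx : x ∈ Icc (0 : ℝ) 1)
    (huv : EqOn u v (Icc 0 1)) (hv : HasDerivAt v v' x) : deriv01 u x = v' := by
  rw [deriv01, derivWithin_congr huv (huv hx)]
  exact hv.hasDerivWithinAt.derivWithin (uniqueDiffOn_Icc zero_lt_one x hx)

/-- Du Bois-Reymond's argument: the primitive of `α - σ` vanishing at `0` is an admissible test
function, and subtracting the identity for `σ` leaves `∫ ‖α - σ‖² = 0`. The natural condition at `1`
comes along because test functions are free there. -/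
theorem IsWeakSolution.flux_eq_integral {A F : ℝ → Vec n → Vec n → Vec n} {u α β : ℝ → Vec n}
    (hu : IsWeakSolution A F u) (hα : Continuous α) (hβ : Continuous β)
    (hαA : ∀ x ∈ Icc (0 : ℝ) 1, A x (u x) (deriv01 u x) = α x)
    (hβF : ∀ x ∈ Icc (0 : ℝ) 1, F x (u x) (deriv01 u x) = β x) :
    ∀ x ∈ Icc (0 : ℝ) 1, α x = ∫ s in (1 : ℝ)..x, β s := by
  set σ : ℝ → Vec n := fun x => ∫ s in (1 : ℝ)..x, β s with hσ
  have hσd : ∀ x, HasDerivAt σ (β x) x := fun x => (hβ.integral_hasStrictDerivAt 1 x).hasDerivAt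
  have hσc : Continuous σ := continuous_iff_continuousAt.2 fun x => (hσd x).continuousAt
  set c : ℝ → Vec n := fun x => α x - σ x with hc
  have hcc : Continuous c := hα.sub hσc
  set φ : ℝ → Vec n := fun x => ∫ s in (0 : ℝ)..x, c s with hφ
  have hφd : ContDiffOn ℝ 1 φ (Icc 0 1) := (contDiff_primitive hcc 0).contDiffOn
  have hφ0 : φ 0 = 0 := by simp [hφ]
  have hφ' : ∀ x ∈ Icc (0 : ℝ) 1, deriv01 φ x = c x := fun x hx =>
    deriv01_of_hasDerivAt hx (fun _ _ => rfl) (hcc.integral_hasStrictDerivAt 0 x).hasDerivAt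
  have h1 := hu.2.2 φ hφd hφ0
  have h2 := integral_inner_deriv01_add_eq_zero hσd hβ (by simp [hσ]) hφd hφ0
  have huIcc : uIcc (0 : ℝ) 1 = Icc 0 1 := uIcc_of_le zero_le_one
  have hφc : Continuous φ := (contDiff_primitive hcc 0).continuous
  have h1' : ∫ x in (0 : ℝ)..1, (inner ℝ (α x) (c x) + inner ℝ (β x) (φ x)) = 0 := by
    refine Eq.trans (intervalIntegral.integral_congr fun x hx => ?_) h1
    rw [huIcc] at hx
    simp only [hαA x hx, hβF x hx, hφ' x hx]
  have h2' : ∫ x in (0 : ℝ)..1, (inner ℝ (σ x) (c x) + inner ℝ (β x) (φ x)) = 0 := by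
    refine Eq.trans (intervalIntegral.integral_congr fun x hx => ?_) h2
    rw [huIcc] at hx
    simp only [hφ' x hx]
  have h3 : ∫ x in (0 : ℝ)..1, ‖c x‖ ^ 2 = 0 := by
    have i1 : Continuous fun x => inner ℝ (α x) (c x) + inner ℝ (β x) (φ x) :=
      (hα.inner hcc).add (hβ.inner hφc)
    have i2 : Continuous fun x => inner ℝ (σ x) (c x) + inner ℝ (β x) (φ x) :=
      (hσc.inner hcc).add (hβ.inner hφc)
    have := intervalIntegral.integral_sub (i1.intervalIntegrable (μ := MeasureTheory.volume) 0 1)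
      (i2.intervalIntegrable 0 1)
    rw [h1', h2', sub_zero] at this
    refine Eq.trans (intervalIntegral.integral_congr fun x _ => ?_) this
    simp only [hc, add_sub_add_right_eq_sub, ← inner_sub_left, real_inner_self_eq_norm_sq]
  intro x hx
  by_contra hne
  have hpos : 0 < ∫ x in (0 : ℝ)..1, ‖c x‖ ^ 2 :=
    intervalIntegral.integral_pos zero_lt_one (hcc.norm.pow 2).continuousOn
      (fun _ _ => by positivity) ⟨x, hx, by
        have : 0 < ‖c x‖ := norm_pos_iff.2 (sub_ne_zero.2 hne)
        positivity⟩
  exact hpos.ne' h3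

theorem bvpSolve_fluxProj_eq {z : Icc (0 : ℝ) 1 →ᵇ Vec n × Vec n} {h : C(ℝ, Vec n × Vec n)}
    (hz : bvpSolve (fluxProj n) h = z) {x : ℝ} (hx : x ∈ Icc (0 : ℝ) 1) :
    extend01 z x = (∫ s in (0 : ℝ)..x, (h s).1, ∫ s in (1 : ℝ)..x, (h s).2) := by
  rw [← bvpIntegral_fluxProj h.continuous, ← hz]
  exact extend01_coe _ ⟨x, hx⟩

theorem deriv01_bvpSolve_fst {z : Icc (0 : ℝ) 1 →ᵇ Vec n × Vec n} {h : C(ℝ, Vec n × Vec n)}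
    (hz : bvpSolve (fluxProj n) h = z) {x : ℝ} (hx : x ∈ Icc (0 : ℝ) 1) :
    deriv01 (fun x => (extend01 z x).1) x = (h x).1 :=
  deriv01_of_hasDerivAt hx (fun x hx => by rw [bvpSolve_fluxProj_eq hz hx])
    (h.continuous.fst.integral_hasStrictDerivAt 0 x).hasDerivAt

theorem isWeakSolution_of_bvpSolve {z : Icc (0 : ℝ) 1 →ᵇ Vec n × Vec n}
    {h : C(ℝ, Vec n × Vec n)} (hz : bvpSolve (fluxProj n) h = z)
    {A F : ℝ → Vec n → Vec n → Vec n}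
    (hA : ∀ x ∈ Icc (0 : ℝ) 1, A x (extend01 z x).1 (h x).1 = (extend01 z x).2)
    (hF : ∀ x ∈ Icc (0 : ℝ) 1, F x (extend01 z x).1 (h x).1 = (h x).2) :
    IsWeakSolution A F fun x => (extend01 z x).1 := by
  have hfst : ∀ x ∈ Icc (0 : ℝ) 1, (extend01 z x).1 = ∫ s in (0 : ℝ)..x, (h s).1 :=
    fun x hx => by rw [bvpSolve_fluxProj_eq hz hx]
  have hsnd : ∀ x ∈ Icc (0 : ℝ) 1, (extend01 z x).2 = ∫ s in (1 : ℝ)..x, (h s).2 :=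
    fun x hx => by rw [bvpSolve_fluxProj_eq hz hx]
  refine ⟨(contDiff_primitive h.continuous.fst 0).contDiffOn.congr hfst, ?_, fun φ hφ hφ0 => ?_⟩
  · simpa using hfst 0 (by simp)
  · refine Eq.trans (intervalIntegral.integral_congr fun x hx => ?_)
      (integral_inner_deriv01_add_eq_zero
        (fun x => (h.continuous.snd.integral_hasStrictDerivAt 1 x).hasDerivAt) h.continuous.snd
        (by simp) hφ hφ0)
    rw [uIcc_of_le zero_le_one] at hx
    simp only [deriv01_bvpSolve_fst hz hx, hA x hx, hF x hx, hsnd x hx]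

/-- The problem `A(x,u,u')' = F(x,u,u')` is equivalent to the first order system `z' = g(x,z)`,
where `z = (u, q)` and `q` is the flux. -/
structure IsFirstOrderForm (A F : ℝ → Vec n → Vec n → Vec n) (A' : ℝ → Vec n × Vec n → Vec n)
    (g : ℝ → Vec n × Vec n → Vec n × Vec n) : Prop where
  continuous_flux : Continuous fun w : ℝ × Vec n × Vec n => A' w.1 w.2
  continuous_field : Continuous fun w : ℝ × Vec n × Vec n => g w.1 w.2
  flux_eq : ∀ x ∈ Icc (0 : ℝ) 1, ∀ u p, ‖u‖ ≤ 1 → A x u p = A' x (u, p)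
  flux_field : ∀ x u q, A' x (u, (g x (u, q)).1) = q
  field_flux : ∀ x u p, (g x (u, A' x (u, p))).1 = p
  reaction_eq : ∀ x ∈ Icc (0 : ℝ) 1, ∀ u q, ‖u‖ ≤ 1 → F x u (g x (u, q)).1 = (g x (u, q)).2

namespace IsFirstOrderForm

variable {A F : ℝ → Vec n → Vec n → Vec n} {A' : ℝ → Vec n × Vec n → Vec n}
  {g : ℝ → Vec n × Vec n → Vec n × Vec n}

theorem continuous_along (h : IsFirstOrderForm A F A' g) (z : Icc (0 : ℝ) 1 →ᵇ Vec n × Vec n) :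
    Continuous fun s => g s (extend01 z s) :=
  h.continuous_field.comp (continuous_id.prodMk (continuous_extend01 z))

theorem isWeakSolution (h : IsFirstOrderForm A F A' g) {z : Icc (0 : ℝ) 1 →ᵇ Vec n × Vec n}
    (hz : bvpSolve (fluxProj n) ⟨fun s => g s (extend01 z s), h.continuous_along z⟩ = z)
    (hz1 : ∀ x ∈ Icc (0 : ℝ) 1, ‖(extend01 z x).1‖ ≤ 1) :
    IsWeakSolution A F fun x => (extend01 z x).1 :=
  isWeakSolution_of_bvpSolve hz
    (fun x hx => (h.flux_eq x hx _ _ (hz1 x hx)).trans (h.flux_field x _ _))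
    (fun x hx => h.reaction_eq x hx _ (extend01 z x).2 (hz1 x hx))

theorem exists_bvpSolve_eq (h : IsFirstOrderForm A F A' g) {u : ℝ → Vec n}
    (hu : IsWeakSolution A F u) (hu1 : ∀ x ∈ Icc (0 : ℝ) 1, ‖u x‖ ≤ 1) :
    ∃ z : Icc (0 : ℝ) 1 →ᵇ Vec n × Vec n,
      (∀ x ∈ Icc (0 : ℝ) 1, (extend01 z x).1 = u x ∧ (g x (extend01 z x)).1 = deriv01 u x) ∧
      bvpSolve (fluxProj n) ⟨fun s => g s (extend01 z s), h.continuous_along z⟩ = z := by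
  have cu : Continuous fun x => u (proj01 x) := continuous_comp_proj01 hu.1.continuousOn
  have cp : Continuous fun x => deriv01 u (proj01 x) :=
    continuous_comp_proj01 (continuousOn_deriv01 hu.1)
  set α : ℝ → Vec n := fun x => A' x (u (proj01 x), deriv01 u (proj01 x)) with hα
  have cα : Continuous α := h.continuous_flux.comp (continuous_id.prodMk (cu.prodMk cp))
  set β : ℝ → Vec n := fun x => (g x (u (proj01 x), α x)).2 with hβ
  have cβ : Continuous β :=
    (h.continuous_field.comp (continuous_id.prodMk (cu.prodMk cα))).snd
  have hg1 : ∀ x ∈ Icc (0 : ℝ) 1, (g x (u x, α x)).1 = deriv01 u x := by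
    intro x hx
    have := h.field_flux x (u x) (deriv01 u x)
    simpa only [hα, proj01_of_mem hx] using this
  have key := hu.flux_eq_integral cα cβ
    (fun x hx => by simp only [hα, proj01_of_mem hx]; exact h.flux_eq x hx _ _ (hu1 x hx))
    (fun x hx => by
      have := h.reaction_eq x hx (u x) (α x) (hu1 x hx)
      rw [hg1 x hx] at this
      simpa only [hβ, proj01_of_mem hx] using this)
  set z : Icc (0 : ℝ) 1 →ᵇ Vec n × Vec n := BoundedContinuousFunction.mkOfCompact
    ⟨fun x => (u (proj01 x), α x), (cu.prodMk cα).comp continuous_subtype_val⟩ with hz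
  have hzx : ∀ x ∈ Icc (0 : ℝ) 1, extend01 z x = (u x, α x) := by
    intro x hx
    rw [show extend01 z x = z ⟨x, hx⟩ from extend01_coe z ⟨x, hx⟩]
    simp [hz, proj01_of_mem hx]
  refine ⟨z, fun x hx => ⟨by rw [hzx x hx], by rw [hzx x hx, hg1 x hx]⟩, ?_⟩
  ext1 x
  have hx := x.2
  rw [bvpSolve_apply, bvpIntegral_fluxProj (ContinuousMap.continuous _),
    ← extend01_coe z x, hzx _ hx]
  have hsub : ∀ t ∈ Icc (0 : ℝ) 1, ∀ s ∈ uIcc t (x : ℝ), s ∈ Icc (0 : ℝ) 1 :=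
    fun t ht s hs => uIcc_subset_Icc ht hx hs
  ext1
  · have hftc := intervalIntegral.integral_derivWithin_Icc_of_contDiffOn_Icc
      (hu.1.mono (Icc_subset_Icc_right hx.2)) hx.1
    rw [hu.2.1, sub_zero] at hftc
    rw [← hftc]
    -- Off the null set `s = x`, both `[0,x]` and `[0,1]` are neighbourhoods of `s`, so the
    -- derivatives within them agree.
    refine intervalIntegral.integral_congr_ae ?_
    have hne : ∀ᵐ s : ℝ, s ≠ x := by simp [MeasureTheory.ae_iff]
    filter_upwards [hne] with s hsx hs
    rw [uIoc_of_le hx.1] at hs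
    have hs' : s ∈ Icc (0 : ℝ) 1 := ⟨hs.1.le, hs.2.trans hx.2⟩
    have hlt : s < x := lt_of_le_of_ne hs.2 hsx
    simp only [ContinuousMap.coe_mk]
    rw [hzx s hs', hg1 s hs', deriv01,
      derivWithin_of_mem_nhds (Icc_mem_nhds hs.1 (hlt.trans_le hx.2)),
      derivWithin_of_mem_nhds (Icc_mem_nhds hs.1 hlt)]
  · rw [key x hx]
    refine intervalIntegral.integral_congr fun s hs => ?_
    have hs' := hsub 1 (by simp) s hs
    simp only [ContinuousMap.coe_mk, hzx s hs', proj01_of_mem hs']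

end IsFirstOrderForm

variable {a f : ℝ → ℝ → Vec n → Vec n → Vec n} {m M : ℝ}

namespace IsAdmissible

theorem isFirstOrderForm_oscillating (h : IsAdmissible a f m M) (ε : ℝ) :
    IsFirstOrderForm (fun x v p => a x (x / ε) v p) (fun x v p => f x (x / ε) v p)
      (fun x w => a (proj01 x) (x / ε) (clampBall w.1) w.2)
      (fun x z => redField a f x (x / ε) z) where
  continuous_flux := h.flux_regular.1.comp_clamp (by fun_prop) (by fun_prop) (by fun_prop)
    (by fun_prop)
  continuous_field := h.isCellFunction_redField.continuous.comp
    (f := fun w : ℝ × Vec n × Vec n => (w.1, w.1 / ε, w.2)) (by fun_prop)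
  flux_eq x hx u p hu := by simp only [proj01_of_mem hx, clampBall_of_le hu]
  flux_field x u q := h.flux_redFlux x (x / ε) (u, q)
  field_flux x u p := h.redFlux_flux x (x / ε) u p
  reaction_eq x hx u q hu := by
    simp only [redField, proj01_of_mem hx, clampBall_of_le hu]

/-- Homogenization becomes plain averaging once the flux is an unknown. -/
theorem isFirstOrderForm_averaged (h : IsAdmissible a f m M) :
    IsFirstOrderForm (homFlux a) (homReaction a f) (extHomFlux a) (avgField a f) where
  continuous_flux := h.continuous_extHomFlux
  continuous_field := h.continuous_avgField
  flux_eq x hx u p hu := by simp only [extHomFlux, proj01_of_mem hx, clampBall_of_le hu]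
  flux_field x u q := by rw [h.avgField_fst, h.extHomFlux_avgFlux]
  field_flux x u p := by rw [h.avgField_fst, h.avgFlux_extHomFlux x (u, p)]
  reaction_eq x hx u q hu := by
    have := h.homReaction_eq x (u, avgFlux a x (u, q))
    rw [h.extHomFlux_avgFlux, proj01_of_mem hx, clampBall_of_le hu] at this
    rw [h.avgField_fst, ← this]

end IsAdmissible

end WeakSolutions

/-! ### Transfer of nondegeneracy -/

section Nondegeneracy

open BoundedContinuousFunction

variable {n : ℕ} {a f : ℝ → ℝ → Vec n → Vec n → Vec n} {m M : ℝ}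

/-- A nondegenerate solution of the homogenized problem is nondegenerate for the averaged first
order system. -/
theorem IsAdmissible.eq_zero_of_bvpLinear_eq (h : IsAdmissible a f m M)
    {z₀ : Icc (0 : ℝ) 1 →ᵇ Vec n × Vec n} {ρ : ℝ} (hρ : ρ < 1)
    (hz₀ : ∀ x, ‖(extend01 z₀ x).1‖ ≤ ρ) {u₀ : ℝ → Vec n}
    (hu₀ : ∀ x ∈ Icc (0 : ℝ) 1, (extend01 z₀ x).1 = u₀ x ∧
      (avgField a f x (extend01 z₀ x)).1 = deriv01 u₀ x)
    (hnd : ∀ u : ℝ → Vec n,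
      IsWeakSolution (linearize (homFlux a) u₀) (linearize (homReaction a f) u₀) u →
        EqOn u 0 (Icc (0 : ℝ) 1))
    {v : Icc (0 : ℝ) 1 →ᵇ Vec n × Vec n}
    (hv : bvpLinear (fluxProj n)
      ⟨fun x => cellMean fun y => redFieldDeriv a f x y (extend01 z₀ x),
        continuous_cellMean (h.isCellCoefficient_redFieldDeriv z₀).continuous⟩ v = v) :
    v = 0 := by
  set D : ℝ → Vec n × Vec n →L[ℝ] Vec n × Vec n :=
    fun x => cellMean fun y => redFieldDeriv a f x y (extend01 z₀ x) with hD
  have hdiff : ∀ x, HasStrictFDerivAt (avgField a f x) (D x) (extend01 z₀ x) :=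
    h.hasStrictFDerivAt_avgField hρ hz₀
  -- For a solution `(w, σ)` of the averaged linear system, `w' = (D (w, σ)).1`. These identities
  -- identify `σ` as its linearized flux and `(D (w, σ)).2` as its linearized reaction.
  have hlin : ∀ x ∈ Icc (0 : ℝ) 1, ∀ w σ,
      linearize (homFlux a) u₀ x w (D x (w, σ)).1 = σ ∧
      linearize (homReaction a f) u₀ x w (D x (w, σ)).1 = (D x (w, σ)).2 := by
    intro x hx w σ
    obtain ⟨T, hT, hTσ⟩ := h.exists_hasStrictFDerivAt_extHomFlux (hdiff x)
    have hpt : ((extend01 z₀ x).1, avgFlux a x (extend01 z₀ x)) = (u₀ x, deriv01 u₀ x) := by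
      rw [← h.avgField_fst (f := f), (hu₀ x hx).1, (hu₀ x hx).2]
    have hinv : extHomFlux a x (u₀ x, deriv01 u₀ x) = (extend01 z₀ x).2 := by
      rw [← hpt]
      exact h.extHomFlux_avgFlux x _ (extend01 z₀ x).2
    have hlt : ‖((u₀ x, deriv01 u₀ x) : Vec n × Vec n).1‖ < 1 := by
      rw [← hpt]
      exact (hz₀ x).trans_lt hρ
    rw [hpt] at hT
    have hpair : ((u₀ x, extHomFlux a x (u₀ x, deriv01 u₀ x)) : Vec n × Vec n) = extend01 z₀ x := by
      rw [hinv, ← (hu₀ x hx).1]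
    -- Chain rule for `f₀`, written as the second component of `avgField` composed with `(u, p) ↦
    -- (u, a₀(x, u, p))`.
    have hR : HasFDerivAt (fun w => (avgField a f x (w.1, extHomFlux a x w)).2)
        ((ContinuousLinearMap.snd ℝ (Vec n) (Vec n)).comp
          ((D x).comp ((ContinuousLinearMap.fst ℝ (Vec n) (Vec n)).prod T)))
        (u₀ x, deriv01 u₀ x) := by
      have h1 : HasFDerivAt (avgField a f x) (D x)
          ((fun w : Vec n × Vec n => (w.1, extHomFlux a x w)) (u₀ x, deriv01 u₀ x)) := by
        simp only [hpair]
        exact (hdiff x).hasFDerivAt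
      exact (HasFDerivAt.comp (g := avgField a f x)
        (f := fun w : Vec n × Vec n => (w.1, extHomFlux a x w)) (u₀ x, deriv01 u₀ x) h1
        (hasFDerivAt_fst.prodMk hT.hasFDerivAt)).snd
    refine ⟨?_, ?_⟩
    · rw [linearize_eq_of_hasFDerivAt hT.hasFDerivAt, hTσ]
      filter_upwards [eventually_clampBall_eq hlt] with w hw
      rw [extHomFlux, proj01_of_mem hx, hw]
    · rw [linearize_eq_of_hasFDerivAt hR]
      · simp [hTσ]
      · filter_upwards [eventually_clampBall_eq hlt] with w hw
        rw [← h.homReaction_eq, proj01_of_mem hx, hw]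
  rw [bvpLinear_apply] at hv
  have hw := hnd _ (isWeakSolution_of_bvpSolve hv
    (fun x hx => (hlin x hx (extend01 v x).1 (extend01 v x).2).1)
    (fun x hx => (hlin x hx (extend01 v x).1 (extend01 v x).2).2))
  ext1 x
  have hx := x.2
  have h1 : (extend01 v x).1 = 0 := hw hx
  -- The first component vanishes on `[0,1]`, hence so does its derivative; inverting the linearized
  -- flux then gives `σ = T (0, 0) = 0`.
  have h2 : (D x (extend01 v x)).1 = 0 := by
    rw [← deriv01_of_hasDerivAt hx hw (hasDerivAt_const _ _)]
    exact (deriv01_bvpSolve_fst hv hx).symm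
  obtain ⟨T, -, hTσ⟩ := h.exists_hasStrictFDerivAt_extHomFlux (hdiff x)
  have h3 := hTσ (extend01 v x).1 (extend01 v x).2
  rw [Prod.mk.eta, h2, h1, ← Prod.zero_eq_mk, map_zero] at h3
  rw [← extend01_coe v x]
  exact Prod.ext h1 h3.symm

end Nondegeneracy

/-! ### Lipschitz dependence on the slow variable -/

section LipschitzInX

variable {n : ℕ} {a f g : ℝ → ℝ → Vec n → Vec n → Vec n} {m M : ℝ}

theorem JointlyContinuous.exists_bound {W : Type} [SeminormedAddCommGroup W]
    {h : ℝ → ℝ → Vec n → Vec n → W} (hh : JointlyContinuous h) (R : ℝ) :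
    ∃ C ≥ 0, ∀ x ∈ Icc (0 : ℝ) 1, ∀ y ∈ Icc (0 : ℝ) 1, ∀ u p, ‖u‖ ≤ R → ‖p‖ ≤ R →
      ‖h x y u p‖ ≤ C := by
  have hK : IsCompact (Icc (0 : ℝ) 1 ×ˢ Icc (0 : ℝ) 1 ×ˢ Metric.closedBall (0 : Vec n) R ×ˢ
      Metric.closedBall (0 : Vec n) R) :=
    isCompact_Icc.prod (isCompact_Icc.prod
      ((isCompact_closedBall _ _).prod (isCompact_closedBall _ _)))
  obtain ⟨C, hC⟩ := hK.exists_bound_of_continuousOn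
    (hh.mono (prod_mono_right (subset_univ _)))
  refine ⟨max C 0, le_max_right _ _, fun x hx y hy u p hu hp => ?_⟩
  exact (hC (x, y, u, p) ⟨hx, hy, by simpa using hu, by simpa using hp⟩).trans (le_max_left _ _)

/-- The mean value inequality in `s`, `u` and `p` in turn, with derivative bounds from compactness;
periodicity reduces `y` to one cell. -/
theorem RegularInX.exists_lipschitz (hX : RegularInX g) (hU : RegularInU g) (hper : PeriodicY g)
    (R : ℝ) : ∃ C ≥ 0, ∀ s ∈ Icc (0 : ℝ) 1, ∀ s' ∈ Icc (0 : ℝ) 1, ∀ y u u' p p',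
      ‖u‖ ≤ R → ‖u'‖ ≤ R → ‖p‖ ≤ R → ‖p'‖ ≤ R →
      ‖g s y u p - g s' y u' p'‖ ≤ C * (|s - s'| + ‖u - u'‖ + ‖p - p'‖) := by
  obtain ⟨C₁, hC₁, h1⟩ := hX.2.exists_bound R
  obtain ⟨C₂, hC₂, h2⟩ := hU.2.2.1.exists_bound R
  obtain ⟨C₃, hC₃, h3⟩ := hU.2.2.2.exists_bound R
  refine ⟨C₁ + C₂ + C₃, by positivity, fun s hs s' hs' y u u' p p' hu hu' hp hp' => ?_⟩
  rw [← Function.Periodic.apply_fract (h := fun y => g s y u p) (fun y => hper s hs y u p) y,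
    ← Function.Periodic.apply_fract (h := fun y => g s' y u' p') (fun y => hper s' hs' y u' p') y]
  have hy := fract_mem_Icc y
  generalize Int.fract y = y at hy
  have e1 : ‖g s y u p - g s' y u p‖ ≤ C₁ * |s - s'| :=
    Convex.norm_image_sub_le_of_norm_derivWithin_le (f := fun s => g s y u p)
      (fun x hx => hX.1 x hx y u p) (fun x hx => h1 x hx y hy u p hu hp) (convex_Icc 0 1) hs' hs
  have e2 : ‖g s' y u p - g s' y u' p‖ ≤ C₂ * ‖u - u'‖ :=
    Convex.norm_image_sub_le_of_norm_fderiv_le (𝕜 := ℝ) (f := fun w => g s' y w p)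
      (s := Metric.closedBall 0 R) (fun w _ => (hU.2.1 s' hs' y w p).1)
      (fun w hw => h2 s' hs' y hy w p (by simpa using hw) hp) (convex_closedBall _ _)
      (by simpa using hu') (by simpa using hu)
  have e3 : ‖g s' y u' p - g s' y u' p'‖ ≤ C₃ * ‖p - p'‖ :=
    Convex.norm_image_sub_le_of_norm_fderiv_le (𝕜 := ℝ) (f := fun w => g s' y u' w)
      (s := Metric.closedBall 0 R) (fun w _ => (hU.2.1 s' hs' y u' w).2)
      (fun w hw => h3 s' hs' y hy u' w hu' (by simpa using hw)) (convex_closedBall _ _)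
      (by simpa using hp') (by simpa using hp)
  have e : g s y u p - g s' y u' p' = (g s y u p - g s' y u p) + (g s' y u p - g s' y u' p)
      + (g s' y u' p - g s' y u' p') := by abel
  rw [e]
  refine (norm_add₃_le.trans (add_le_add (add_le_add e1 e2) e3)).trans ?_
  have a1 := abs_nonneg (s - s')
  have a2 := norm_nonneg (u - u')
  have a3 := norm_nonneg (p - p')
  nlinarith [mul_nonneg hC₁ a2, mul_nonneg hC₁ a3, mul_nonneg hC₂ a1, mul_nonneg hC₂ a3,
    mul_nonneg hC₃ a1, mul_nonneg hC₃ a2]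

theorem IsAdmissible.exists_lipschitz_redField (h : IsAdmissible a f m M) (haX : RegularInX a)
    (hfX : RegularInX f) {z : BoundedContinuousFunction (Icc (0 : ℝ) 1) (Vec n × Vec n)}
    (hz1 : ∀ x, ‖(extend01 z x).1‖ ≤ 1) {K : ℝ}
    (hK : ∀ s ∈ Icc (0 : ℝ) 1, ∀ s' ∈ Icc (0 : ℝ) 1,
      ‖extend01 z s - extend01 z s'‖ ≤ K * |s - s'|) :
    ∃ Λ, ∀ s ∈ Icc (0 : ℝ) 1, ∀ s' ∈ Icc (0 : ℝ) 1, ∀ y,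
      ‖redField a f s y (extend01 z s) - redField a f s' y (extend01 z s')‖ ≤ Λ * |s - s'| := by
  have hb := h.isCellFunction_redFlux.comp (continuous_extend01 z) (extend01_proj01 z)
  obtain ⟨H, hH0, hH⟩ := hb.exists_bound
  obtain ⟨Ca, hCa, ha⟩ := haX.exists_lipschitz h.flux_regular h.flux_periodic (max 1 H)
  obtain ⟨Cf, hCf, hf⟩ := hfX.exists_lipschitz h.reaction_regular h.reaction_periodic (max 1 H)
  have hm := h.pos
  set L : ℝ := m⁻¹ * (Ca * (1 + K) + K) with hL
  have hU : ∀ s, ‖(extend01 z s).1‖ ≤ max 1 H := fun s => (hz1 s).trans (le_max_left _ _)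
  have hP : ∀ s y, ‖redFlux a s y (extend01 z s)‖ ≤ max 1 H := fun s y =>
    (hH s y).trans (le_max_right _ _)
  have hflux : ∀ s ∈ Icc (0 : ℝ) 1, ∀ s' ∈ Icc (0 : ℝ) 1, ∀ y,
      ‖redFlux a s y (extend01 z s) - redFlux a s' y (extend01 z s')‖ ≤ L * |s - s'| := by
    intro s hs s' hs' y
    set p := redFlux a s y (extend01 z s) with hp
    set p' := redFlux a s' y (extend01 z s') with hp'
    have e1 := h.flux_redFlux s y (extend01 z s)
    have e2 := h.flux_redFlux s' y (extend01 z s')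
    rw [proj01_of_mem hs, clampBall_of_le (hz1 s), ← hp] at e1
    rw [proj01_of_mem hs', clampBall_of_le (hz1 s'), ← hp'] at e2
    -- Strong monotonicity bounds `m * ‖p - p'‖` by the flux difference at `s'`. Since `p` has flux
    -- `q(s)` at `s`, that difference comes only from the change of `x`, `u` and `q`.
    have h1 := (h.stronglyMonotone s' y (extend01 z s').1).antilipschitz p p'
    rw [proj01_of_mem hs', clampBall_of_le (hz1 s'), e2] at h1
    have h2 := ha s' hs' s hs y (extend01 z s').1 (extend01 z s).1 p p (hU s') (hU s) (hP s y)
      (hP s y)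
    rw [e1, sub_self, norm_zero, add_zero] at h2
    have hKz := hK s hs s' hs'
    have hKz' := hK s' hs' s hs
    have hsymm : |s' - s| = |s - s'| := abs_sub_comm _ _
    have h3 : ‖a s' y (extend01 z s').1 p - (extend01 z s').2‖
        ≤ Ca * (|s - s'| + K * |s - s'|) + K * |s - s'| := by
      have e : a s' y (extend01 z s').1 p - (extend01 z s').2
          = (a s' y (extend01 z s').1 p - (extend01 z s).2)
            + ((extend01 z s).2 - (extend01 z s').2) := by abel
      rw [e]
      refine (norm_add_le _ _).trans (add_le_add (h2.trans ?_)
        ((norm_snd_le (extend01 z s - extend01 z s')).trans hKz))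
      rw [hsymm] at hKz' ⊢
      exact mul_le_mul_of_nonneg_left (add_le_add le_rfl
        ((norm_fst_le (extend01 z s' - extend01 z s)).trans hKz')) hCa
    rw [hL, mul_assoc, inv_mul_eq_div, le_div_iff₀' hm]
    refine (h1.trans h3).trans (le_of_eq (by ring))
  refine ⟨max L (Cf * (1 + K + L)), fun s hs s' hs' y => ?_⟩
  rw [Prod.norm_def, max_mul_of_nonneg _ _ (abs_nonneg _)]
  refine max_le_max (hflux s hs s' hs' y) ?_
  simp only [redField, Prod.snd_sub, proj01_of_mem hs, proj01_of_mem hs', clampBall_of_le (hz1 s),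
    clampBall_of_le (hz1 s')]
  refine (hf s hs s' hs' y _ _ _ _ (hU s) (hU s') (hP s y) (hP s' y)).trans ?_
  rw [mul_assoc]
  refine mul_le_mul_of_nonneg_left ?_ hCf
  have := (norm_fst_le (extend01 z s - extend01 z s')).trans (hK s hs s' hs')
  have h2 := hflux s hs s' hs' y
  rw [Prod.fst_sub] at this
  linarith

end LipschitzInX

/-! ### A priori closeness of the flux -/

section APriori

open BoundedContinuousFunction

theorem bvpSolve_sub_eq_integral {X : Type*} [NormedAddCommGroup X] [NormedSpace ℝ X]
    {B : X →L[ℝ] X} {h : C(ℝ, X)} {z : Icc (0 : ℝ) 1 →ᵇ X} (hz : bvpSolve B h = z) {s t : ℝ}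
    (hs : s ∈ Icc (0 : ℝ) 1) (ht : t ∈ Icc (0 : ℝ) 1) :
    extend01 z t - extend01 z s = ∫ x in s..t, h x := by
  have e : ∀ x ∈ Icc (0 : ℝ) 1, extend01 z x = bvpIntegral B h x := fun x hx => by
    rw [← hz]
    exact extend01_coe _ ⟨x, hx⟩
  rw [e t ht, e s hs]
  simp only [bvpIntegral, sub_sub_sub_cancel_right]
  exact intervalIntegral.integral_interval_sub_left (h.continuous.intervalIntegrable _ _)
    (h.continuous.intervalIntegrable _ _)

/-- A continuous real function that exceeds `r` somewhere on `[0,1]`, but not at `1`, takes the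
value `r` at a last point. -/
theorem exists_last_eq {e : ℝ → ℝ} (he : Continuous e) {r : ℝ} (h1 : e 1 ≤ r)
    {x : ℝ} (hx : x ∈ Icc (0 : ℝ) 1) (hxr : r < e x) :
    ∃ t ∈ Icc (0 : ℝ) 1, e t = r ∧ ∀ s ∈ Icc t 1, e s ≤ r := by
  have hK : IsCompact (Icc (0 : ℝ) 1 ∩ {s | r ≤ e s}) :=
    isCompact_Icc.inter_right (isClosed_le continuous_const he)
  obtain ⟨t, ⟨ht, htr⟩, hmax⟩ := hK.exists_isGreatest ⟨x, hx, hxr.le⟩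
  have htr : r ≤ e t := htr
  have heq : e t = r := by
    obtain ⟨s, hs, hsr⟩ := intermediate_value_Icc' ht.2 he.continuousOn ⟨h1, htr⟩
    have : s ≤ t := hmax ⟨⟨ht.1.trans hs.1, hs.2⟩, hsr.ge⟩
    rw [← hsr, le_antisymm this hs.1]
  refine ⟨t, ht, heq, fun s hs => ?_⟩
  by_contra hc
  push Not at hc
  have : s ≤ t := hmax ⟨⟨ht.1.trans hs.1, hs.2⟩, hc.le⟩
  rw [le_antisymm this hs.1, heq] at hc
  exact lt_irrefl _ hc

variable {n : ℕ} {a f : ℝ → ℝ → Vec n → Vec n → Vec n} {m M : ℝ}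

/-- Strong monotonicity of the averaged flux along functions of bounded slope. -/
theorem IsAdmissible.inner_avgFlux_sub_ge (h : IsAdmissible a f m M) {x r k : ℝ}
    (hr : 0 < r) (u q q₀ e : Vec n) (hlow : r / 2 ≤ ‖q - q₀‖) (hclose : ‖q - q₀ - e‖ ≤ k)
    (hk : m⁻¹ * k ≤ m / M ^ 2 * r / 8) :
    3 / 16 * (m / M ^ 2) * r ^ 2 ≤ inner ℝ (avgFlux a x (u, q) - avgFlux a x (u, q₀)) e := by
  have hμ := h.avg_pos
  set μ := m / M ^ 2 with hμd
  have h1 := h.avgFlux_stronglyMonotone x u q q₀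
  have h2 := h.norm_avgFlux_sub_le x u q q₀
  set B := avgFlux a x (u, q) - avgFlux a x (u, q₀) with hB
  set t := ‖q - q₀‖ with ht
  have h3 : inner ℝ B (q - q₀ - e) ≤ m⁻¹ * t * k :=
    (real_inner_le_norm _ _).trans (mul_le_mul h2 hclose (norm_nonneg _)
      (by have := h.pos; positivity))
  have e1 : inner ℝ B e = inner ℝ B (q - q₀) - inner ℝ B (q - q₀ - e) := by
    rw [← inner_sub_right]
    congr 1
    abel
  rw [e1]
  have h4 : m⁻¹ * t * k ≤ t * (μ * r / 8) := by
    calc m⁻¹ * t * k = t * (m⁻¹ * k) := by ring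
      _ ≤ _ := mul_le_mul_of_nonneg_left hk (norm_nonneg _)
  have h1' : μ * t ^ 2 ≤ inner ℝ B (q - q₀) := h1
  have h5 : 3 / 16 * μ * r ^ 2 ≤ μ * t ^ 2 - t * (μ * r / 8) := by
    -- The quadratic `t² - r t / 8 - 3 r² / 16` has these two factors.
    have : 0 ≤ μ * ((t - r / 2) * (t + 3 * r / 8)) := by
      have : 0 ≤ t - r / 2 := by linarith
      positivity
    nlinarith
  linarith

/-- If the first component of a solution of the oscillating system is close to the one of the
averaged system, then so is the second component. -/
theorem IsAdmissible.exists_flux_close (h : IsAdmissible a f m M)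
    {z₀ : Icc (0 : ℝ) 1 →ᵇ Vec n × Vec n}
    (hz₀ : averagedMap (fluxProj n) h.isCellFunction_redField z₀ = z₀) {r : ℝ} (hr : 0 < r) :
    ∃ δ > 0, ∃ ε₁ > 0, ∀ ε ∈ Ioc 0 ε₁, ∀ z,
      oscillatingMap (fluxProj n) h.isCellFunction_redField ε z = z →
      (∀ x ∈ Icc (0 : ℝ) 1, ‖(extend01 z x).1 - (extend01 z₀ x).1‖ ≤ δ) →
      ∀ x ∈ Icc (0 : ℝ) 1, ‖(extend01 z x).2 - (extend01 z₀ x).2‖ ≤ r := by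
  have hm := h.pos
  have hμ := h.avg_pos
  set μ := m / M ^ 2 with hμd
  set S : Set (Vec n × Vec n) := Metric.closedBall 0 (‖z₀‖ + r) with hS
  have hSc : IsCompact S := isCompact_closedBall _ _
  have hmemS : ∀ x w, ‖w - extend01 z₀ x‖ ≤ r → w ∈ S := by
    intro x w hw
    rw [hS, mem_closedBall_zero_iff]
    calc ‖w‖ = ‖extend01 z₀ x + (w - extend01 z₀ x)‖ := by congr 1; abel
      _ ≤ _ := (norm_add_le _ _).trans (add_le_add (norm_extend01_le z₀ x) hw)
  have hG := h.isCellFunction_redField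
  have hb := h.isCellFunction_redFlux
  obtain ⟨H, hH0, hH⟩ := exists_uniform_bound hSc hG.proj hG.periodic hG.continuous
  obtain ⟨δ₁, hδ₁, hmod⟩ := exists_uniform_modulus hSc hb.proj hb.periodic hb.continuous
    (κ := μ * r / 32) (by positivity)
  -- Length of the test interval: both fluxes have slope at most `H`, so their difference moves by
  -- at most `2 * H * l`. The first entry keeps it above `r / 2`, the second keeps it aligned with
  -- its initial direction.
  set l : ℝ := min (r / (4 * H)) (μ * r / 8 * m / (2 * H)) with hl
  have hl0 : 0 < l := by positivity
  have hl1 : 2 * H * l ≤ r / 2 := by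
    have := min_le_left (r / (4 * H)) (μ * r / 8 * m / (2 * H))
    rw [← hl, le_div_iff₀' (by positivity)] at this
    linarith
  have hl2 : m⁻¹ * (2 * H * l) ≤ μ * r / 8 := by
    have := min_le_right (r / (4 * H)) (μ * r / 8 * m / (2 * H))
    rw [← hl, le_div_iff₀' (by positivity)] at this
    rwa [inv_mul_eq_div, div_le_iff₀ hm]
  -- Error budget in units of `l * μ * r / 32`: two for averaging, one for replacing `u` by `u₀`,
  -- one for the two endpoint values of `u - u₀`. The total `1/8` is less than the `3/16` from
  -- monotonicity.
  set δ : ℝ := min (min r (δ₁ / 2)) (l * (μ * r) / 64) with hδ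
  have hδ0 : 0 < δ := by positivity
  have hδr : δ ≤ r := (min_le_left _ _).trans (min_le_left _ _)
  have hδδ₁ : δ < δ₁ := by
    have := (min_le_left _ _ : δ ≤ _).trans (min_le_right _ _)
    linarith
  have hδl : 2 * δ ≤ l * (μ * r) / 32 := by
    have : δ ≤ l * (μ * r) / 64 := min_le_right _ _
    linarith
  set ε₁ : ℝ := min (δ₁ / (2 * (1 + H))) (l * (μ * r) / 32 / (2 * H)) with hε₁
  refine ⟨δ, hδ0, ε₁, by positivity, fun ε hε z hz hu => ?_⟩
  have hε0 : 0 < ε := hε.1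
  have hεδ₁ : (1 + H) * ε < δ₁ := by
    have := hε.2.trans (min_le_left _ _)
    rw [le_div_iff₀' (by positivity)] at this
    linarith
  have hεl : 2 * H * ε ≤ l * (μ * r) / 32 := by
    have := hε.2.trans (min_le_right _ _)
    rwa [le_div_iff₀' (by positivity)] at this
  by_contra hcon
  push Not at hcon
  obtain ⟨x₁, hx₁, hx₁r⟩ := hcon
  set e : ℝ → Vec n := fun x => (extend01 z x).2 - (extend01 z₀ x).2 with he
  have he1 : e 1 = 0 := by
    have h1 := bvpSolve_fluxProj_eq hz (x := 1) (by simp)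
    have h2 := bvpSolve_fluxProj_eq hz₀ (x := 1) (by simp)
    simp [he, h1, h2]
  have hce : Continuous e := (continuous_extend01 z).snd.sub (continuous_extend01 z₀).snd
  -- Nothing bounds the flux of `z` a priori. After the last time its deviation equals `r`, however,
  -- the trajectory stays in `S`, where `H` and the modulus are available.
  obtain ⟨t, ht, htr, htle⟩ := exists_last_eq hce.norm (r := r) (by simp [he1, hr.le]) hx₁ hx₁r
  have hIcc : ∀ s ∈ Icc t 1, s ∈ Icc (0 : ℝ) 1 := fun s hs => ⟨ht.1.trans hs.1, hs.2⟩
  have hzS : ∀ s ∈ Icc t 1, extend01 z s ∈ S := fun s hs =>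
    hmemS s _ (max_le ((hu s (hIcc s hs)).trans hδr) (htle s hs))
  have hz₀S : ∀ s, extend01 z₀ s ∈ S := fun s => hmemS s _ (by simpa using hr.le)
  have hzlip : ∀ s ∈ Icc t 1, ∀ s' ∈ Icc t 1,
      ‖extend01 z s - extend01 z s'‖ ≤ H * |s - s'| := by
    intro s hs s' hs'
    rw [bvpSolve_sub_eq_integral hz (hIcc s' hs') (hIcc s hs)]
    refine intervalIntegral.norm_integral_le_of_norm_le_const fun x hx => ?_
    exact hH _ _ _ (hzS x (uIcc_subset_Icc hs' hs (uIoc_subset_uIcc hx)))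
  have hz₀lip : ∀ s ∈ Icc t 1, ∀ s' ∈ Icc t 1,
      ‖extend01 z₀ s - extend01 z₀ s'‖ ≤ H * |s - s'| := by
    intro s hs s' hs'
    rw [bvpSolve_sub_eq_integral hz₀ (hIcc s' hs') (hIcc s hs)]
    refine intervalIntegral.norm_integral_le_of_norm_le_const fun x hx => ?_
    exact norm_cellMean_le fun y => hH _ _ _ (hz₀S x)
  have helip : ∀ s ∈ Icc t 1, ‖e s - e t‖ ≤ 2 * H * |s - t| := by
    intro s hs
    have htt : t ∈ Icc t 1 := ⟨le_rfl, ht.2⟩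
    have e1 : e s - e t = (extend01 z s - extend01 z t).2 - (extend01 z₀ s - extend01 z₀ t).2 := by
      simp only [he, Prod.snd_sub]
      abel
    rw [e1]
    refine (norm_sub_le _ _).trans ((add_le_add ((norm_snd_le _).trans (hzlip s hs t htt))
      ((norm_snd_le _).trans (hz₀lip s hs t htt))).trans (le_of_eq (by ring)))
  -- The deviation must fall from `r` at `t` to `0` at `1` with slope at most `2 * H`, so `t` cannot
  -- be too close to `1`.
  have htl : t + l ≤ 1 := by
    have h1 := helip 1 ⟨ht.2, le_rfl⟩
    rw [he1, zero_sub, norm_neg, htr, abs_of_nonneg (by linarith [ht.2])] at h1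
    have : 2 * H * l ≤ 2 * H * (1 - t) := by linarith
    have := le_of_mul_le_mul_left this (by positivity)
    linarith
  have hmem : ∀ s ∈ Icc t (t + l), s ∈ Icc t 1 := fun s hs => ⟨hs.1, hs.2.trans htl⟩
  have htI : t ∈ Icc (0 : ℝ) 1 := ht
  have htlI : t + l ∈ Icc (0 : ℝ) 1 := ⟨by linarith [ht.1], htl⟩
  -- The averaging estimate requires bounds for all real `s`, so the part of `z` over `[t,1]` is
  -- extended by constants.
  set z' : ℝ → Vec n × Vec n := fun s => extend01 z (proj01 (max t s)) with hz'
  have hpm : ∀ s, proj01 (max t s) ∈ Icc t 1 := fun s =>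
    ⟨by
      have : proj01 t ≤ proj01 (max t s) := monotone_proj01 (le_max_left _ _)
      rwa [proj01_of_mem ht] at this, (proj01_mem _).2⟩
  have hcz' : Continuous z' := by
    have := continuous_extend01 z
    have := continuous_proj01
    fun_prop
  have hz'eq : ∀ s ∈ Icc t (t + l), z' s = extend01 z s := fun s hs => by
    simp only [hz', max_eq_right hs.1, proj01_of_mem (hIcc s (hmem s hs))]
  have hz'lip : ∀ s s', ‖z' s - z' s'‖ ≤ H * |s - s'| := by
    intro s s'
    refine (hzlip _ (hpm s) _ (hpm s')).trans (mul_le_mul_of_nonneg_left ?_ hH0.le)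
    refine (abs_proj01_sub_le _ _).trans ?_
    have := abs_max_sub_max_le_max t s t s'
    simpa using this
  have havg := norm_integral_oscillating_sub_mean_le (h := fun s y => redFlux a s y (z' s))
    (hb.continuous.comp (f := fun v : ℝ × ℝ => (v.1, v.2, z' v.1)) (by fun_prop))
    (fun s y => hb.periodic _ _ _) (H := H) (ω := μ * r / 32) hε0
    (fun s y => (norm_fst_le (redField a f s y (z' s))).trans (hH _ _ _ (hzS _ (hpm s))))
    (fun s s' y hs => by
      refine (hmod s s' y _ (hzS _ (hpm s)) _ ?_ ?_).le
      · nlinarith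
      · rw [dist_eq_norm]
        have : H * |s - s'| ≤ H * ε := mul_le_mul_of_nonneg_left hs hH0.le
        have := hz'lip s s'
        simp only [hz'] at this
        linarith) (a := t) (b := t + l) (by linarith)
  rw [add_sub_cancel_left] at havg
  have hbc : Continuous fun w : ℝ × Vec n × Vec n => avgFlux a w.1 w.2 := h.continuous_avgFlux
  have c0 : Continuous fun s => redFlux a s (s / ε) (extend01 z s) :=
    hb.continuous.comp (f := fun s : ℝ => (s, s / ε, extend01 z s))
      (continuous_id.prodMk ((continuous_id.div_const ε).prodMk (continuous_extend01 z)))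
  have c1 : Continuous fun s => avgFlux a s (extend01 z s) :=
    hbc.comp (continuous_id.prodMk (continuous_extend01 z))
  have c2 : Continuous fun s => avgFlux a s ((extend01 z₀ s).1, (extend01 z s).2) :=
    hbc.comp (continuous_id.prodMk ((continuous_extend01 z₀).fst.prodMk (continuous_extend01 z).snd))
  have c3 : Continuous fun s => avgFlux a s (extend01 z₀ s) :=
    hbc.comp (continuous_id.prodMk (continuous_extend01 z₀))
  have huIcc : uIcc t (t + l) = Icc t (t + l) := uIcc_of_le (by linarith)
  have hv : ∀ {k : ℝ → Vec n}, Continuous k →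
      IntervalIntegrable k MeasureTheory.volume t (t + l) := fun hk => hk.intervalIntegrable _ _
  have havg' : ‖(∫ s in t..(t + l), redFlux a s (s / ε) (extend01 z s))
      - ∫ s in t..(t + l), avgFlux a s (extend01 z s)‖ ≤ l * (μ * r) / 32 + l * (μ * r) / 32 := by
    rw [← intervalIntegral.integral_sub (hv c0) (hv c1)]
    have : ∫ s in t..(t + l), (redFlux a s (s / ε) (extend01 z s) - avgFlux a s (extend01 z s))
        = ∫ s in t..(t + l), (redFlux a s (s / ε) (z' s)
          - cellMean fun y => redFlux a s y (z' s)) := by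
      refine intervalIntegral.integral_congr fun s hs => ?_
      rw [huIcc] at hs
      simp only [hz'eq s hs, avgFlux]
    rw [this]
    refine havg.trans ?_
    linarith
  have hz1 : ∫ s in t..(t + l), redFlux a s (s / ε) (extend01 z s)
      = (extend01 z (t + l)).1 - (extend01 z t).1 := by
    have := congrArg Prod.fst (bvpSolve_sub_eq_integral hz htI htlI)
    rw [Prod.fst_sub] at this
    rw [this]
    exact (intervalIntegral_fst ((h.isFirstOrderForm_oscillating ε).continuous_along z) _ _).symm
  have hz2 : ∫ s in t..(t + l), avgFlux a s (extend01 z₀ s)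
      = (extend01 z₀ (t + l)).1 - (extend01 z₀ t).1 := by
    have := congrArg Prod.fst (bvpSolve_sub_eq_integral hz₀ htI htlI)
    rw [Prod.fst_sub] at this
    rw [this]
    simp only [← h.avgField_fst (f := f)]
    exact (intervalIntegral_fst (h.isFirstOrderForm_averaged.continuous_along z₀) _ _).symm
  -- Monotonicity compares fluxes only at equal `u`, so `u` is first replaced by `u₀`.
  have hswitch : ‖(∫ s in t..(t + l), avgFlux a s ((extend01 z₀ s).1, (extend01 z s).2))
      - ∫ s in t..(t + l), avgFlux a s (extend01 z s)‖ ≤ l * (μ * r) / 32 := by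
    rw [← intervalIntegral.integral_sub (hv c2) (hv c1)]
    refine (intervalIntegral.norm_integral_le_of_norm_le_const (C := μ * r / 32)
      fun s hs => ?_).trans_eq ?_
    · have hs : s ∈ Icc t (t + l) := by
        rw [← huIcc]
        exact uIoc_subset_uIcc hs
      have hsI := hIcc s (hmem s hs)
      have hc : ∀ w, Continuous fun y => redFlux a s y w := fun w => h.continuous_redFlux_cell s w
      rw [avgFlux, avgFlux, ← cellMean_sub (hc _) (hc _)]
      refine norm_cellMean_le fun y => (hmod s s y _ ?_ _ (by simpa using hδ₁) ?_).le
      · refine hmemS s _ (max_le (by simpa using hr.le) (htle s (hmem s hs)))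
      · rw [dist_eq_norm, Prod.norm_def]
        refine max_lt ?_ (by simpa using hδ₁)
        rw [Prod.fst_sub, norm_sub_rev]
        exact (hu s hsI).trans_lt hδδ₁
    · rw [add_sub_cancel_left, abs_of_pos hl0]
      ring
  have hupper : ‖∫ s in t..(t + l), (avgFlux a s ((extend01 z₀ s).1, (extend01 z s).2)
      - avgFlux a s (extend01 z₀ s))‖ ≤ l * (μ * r) / 8 := by
    rw [intervalIntegral.integral_sub (hv c2) (hv c3), hz2]
    rw [hz1] at havg'
    have e1 := hu (t + l) htlI
    have e2 := hu t htI
    generalize (∫ s in t..(t + l), avgFlux a s ((extend01 z₀ s).1, (extend01 z s).2)) = I₂ at *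
    generalize (∫ s in t..(t + l), avgFlux a s (extend01 z s)) = I₁ at *
    have e3 : I₂ - ((extend01 z₀ (t + l)).1 - (extend01 z₀ t).1)
        = (I₂ - I₁) - ((extend01 z (t + l)).1 - (extend01 z t).1 - I₁)
          + ((extend01 z (t + l)).1 - (extend01 z₀ (t + l)).1)
          - ((extend01 z t).1 - (extend01 z₀ t).1) := by abel
    rw [e3]
    refine (norm_sub_le _ _).trans ((add_le_add ((norm_add_le _ _).trans (add_le_add
      ((norm_sub_le _ _).trans (add_le_add hswitch havg')) e1)) e2).trans ?_)
    linarith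
  have hlower : l * (3 / 16 * μ * r ^ 2) ≤ inner ℝ (∫ s in t..(t + l),
      (avgFlux a s ((extend01 z₀ s).1, (extend01 z s).2) - avgFlux a s (extend01 z₀ s))) (e t) := by
    have c4 : Continuous fun s => avgFlux a s ((extend01 z₀ s).1, (extend01 z s).2)
        - avgFlux a s (extend01 z₀ s) := c2.sub c3
    have e1 : inner ℝ (∫ s in t..(t + l),
        (avgFlux a s ((extend01 z₀ s).1, (extend01 z s).2) - avgFlux a s (extend01 z₀ s))) (e t)
        = ∫ s in t..(t + l), inner ℝ (avgFlux a s ((extend01 z₀ s).1, (extend01 z s).2)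
          - avgFlux a s (extend01 z₀ s)) (e t) := by
      rw [real_inner_comm, ← innerSL_apply_apply ℝ,
        ← ContinuousLinearMap.intervalIntegral_comp_comm _ (hv c4)]
      simp only [innerSL_apply_apply, real_inner_comm]
    rw [e1]
    have := intervalIntegral.integral_mono_on (a := t) (b := t + l) (μ := MeasureTheory.volume)
      (by linarith) ((continuous_const (y := 3 / 16 * μ * r ^ 2)).intervalIntegrable _ _)
      ((c4.inner (continuous_const (y := e t))).intervalIntegrable _ _) (fun s hs => by
        have hes := helip s (hmem s hs)
        have hst : |s - t| ≤ l := by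
          rw [abs_of_nonneg (by linarith [hs.1])]
          linarith [hs.2]
        have hes' : ‖e s - e t‖ ≤ 2 * H * l :=
          hes.trans (mul_le_mul_of_nonneg_left hst (by positivity))
        refine h.inner_avgFlux_sub_ge hr (extend01 z₀ s).1 (extend01 z s).2 (extend01 z₀ s).2
          (e t) ?_ hes' hl2
        have := norm_sub_norm_le (e t) (e s)
        rw [norm_sub_rev (e t) (e s)] at this
        have he' : ‖e s‖ = ‖(extend01 z s).2 - (extend01 z₀ s).2‖ := rfl
        rw [← he']
        linarith)
    rwa [intervalIntegral.integral_const, add_sub_cancel_left, smul_eq_mul] at this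
  have hfin := hlower.trans ((real_inner_le_norm _ _).trans
    (mul_le_mul_of_nonneg_right hupper (norm_nonneg _)))
  rw [htr] at hfin
  have hpos : 0 < l * μ * r ^ 2 := by positivity
  nlinarith

end APriori

/-! ### The supremum norm on `[0,1]` -/

section SupNorm

variable {n : ℕ}

theorem supNorm_nonneg (u : ℝ → Vec n) : 0 ≤ supNorm u :=
  Real.sSup_nonneg (by rintro _ ⟨x, _, rfl⟩; exact norm_nonneg _)

theorem norm_le_supNorm {u : ℝ → Vec n} (hu : ContinuousOn u (Icc 0 1)) {x : ℝ}
    (hx : x ∈ Icc (0 : ℝ) 1) : ‖u x‖ ≤ supNorm u :=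
  le_csSup (isCompact_Icc.image_of_continuousOn hu.norm).bddAbove ⟨x, hx, rfl⟩

theorem supNorm_le {u : ℝ → Vec n} {c : ℝ} (hc : ∀ x ∈ Icc (0 : ℝ) 1, ‖u x‖ ≤ c) :
    supNorm u ≤ c :=
  csSup_le ((nonempty_Icc.2 zero_le_one).image _) (by rintro _ ⟨x, hx, rfl⟩; exact hc x hx)

end SupNorm

/-! ### Existence, uniqueness and rate -/

theorem extend01_eq_proj01 {X : Type*} [NormedAddCommGroup X]
    (v : BoundedContinuousFunction (Icc (0 : ℝ) 1) X) {P : X → Prop}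
    (h : ∀ x ∈ Icc (0 : ℝ) 1, P (extend01 v x)) (x : ℝ) : P (extend01 v x) := by
  rw [← extend01_proj01]
  exact h _ (proj01_mem x)

theorem theorem1p1 (n : ℕ) (a f : ℝ → ℝ → Vec n → Vec n → Vec n)
    (ha_per : PeriodicY a) (hf_per : PeriodicY f)
    (ha_reg : RegularInU a) (hf_reg : RegularInU f)
    (h_mon : ∃ m M : ℝ, 0 < m ∧ m ≤ M ∧ StronglyMonotoneLipschitz a m M)
    (u₀ : ℝ → Vec n)
    (hu₀ : IsWeakSolution (homFlux a) (homReaction a f) u₀)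
    (hu₀_lt : supNorm u₀ < 1)
    (h_nondeg : ∀ u : ℝ → Vec n,
      IsWeakSolution (linearize (homFlux a) u₀) (linearize (homReaction a f) u₀) u →
        EqOn u 0 (Icc (0 : ℝ) 1)) :
    ∃ ε₀ > 0, ∃ δ > 0, ∃ uε : ℝ → ℝ → Vec n,
      (∀ ε ∈ Ioc (0 : ℝ) ε₀,
        (IsWeakSolutionEps a f ε (uε ε) ∧ supNorm (uε ε - u₀) ≤ δ) ∧
        ∀ w : ℝ → Vec n, IsWeakSolutionEps a f ε w → supNorm (w - u₀) ≤ δ →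
          EqOn w (uε ε) (Icc (0 : ℝ) 1)) ∧
      Tendsto (fun ε => supNorm (uε ε - u₀)) (𝓝[>] 0) (𝓝 0) ∧
      (RegularInX a ∧ RegularInX f →
        (fun ε => supNorm (uε ε - u₀)) =O[𝓝[>] 0] (fun ε : ℝ => ε)) := by
  obtain ⟨m, M, hm, hmM, hmono⟩ := h_mon
  have h : IsAdmissible a f m M := ⟨ha_per, hf_per, ha_reg, hf_reg, hm, hmM, hmono⟩
  have hG := h.isCellFunction_redField
  set ρ := supNorm u₀ with hρ
  have hu₀c : ContinuousOn u₀ (Icc 0 1) := hu₀.1.continuousOn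
  have hu₀ρ : ∀ x ∈ Icc (0 : ℝ) 1, ‖u₀ x‖ ≤ ρ := fun x hx => norm_le_supNorm hu₀c hx
  obtain ⟨z₀, hz₀u, hz₀⟩ := h.isFirstOrderForm_averaged.exists_bvpSolve_eq hu₀
    fun x hx => (hu₀ρ x hx).trans hu₀_lt.le
  replace hz₀ : averagedMap (fluxProj n) hG z₀ = z₀ := hz₀
  have hz₀ρ : ∀ x, ‖(extend01 z₀ x).1‖ ≤ ρ := extend01_eq_proj01 z₀ (P := fun w => ‖w.1‖ ≤ ρ)
    fun x hx => by rw [(hz₀u x hx).1]; exact hu₀ρ x hx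
  -- The cap `1 - ρ` on `r` keeps the first components of solutions in the closed unit ball, where
  -- the extended and the original problem coincide.
  obtain ⟨r, ⟨hr0, hr1⟩, ε₁, hε₁, C, hsol⟩ := exists_unique_oscillatingMap_fixedPoint (fluxProj n)
    hG (h.isCellCoefficient_redFieldDeriv z₀)
    (fun κ hκ => h.exists_linearization_bound hu₀_lt hz₀ρ hκ) hz₀
    (fun v hv => h.eq_zero_of_bvpLinear_eq hu₀_lt hz₀ρ hz₀u h_nondeg hv)
    (r₁ := 1 - ρ) (by linarith)
  obtain ⟨δ₁, hδ₁, ε₂, hε₂, hflux⟩ := h.exists_flux_close hz₀ hr0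
  -- `δ₁` makes the flux of any competitor `r`-close, and `r` bounds its first component; together
  -- they place it in the ball of uniqueness.
  set δ := min δ₁ r with hδ
  have hδ0 : 0 < δ := lt_min hδ₁ hr0
  -- The residual is made small enough for the constructed solution to lie within `δ`, not merely
  -- within `r`; the `+ 1` avoids dividing by zero.
  obtain ⟨ε₃, hε₃, hres⟩ := exists_oscillatingMap_sub_averagedMap_le (fluxProj n) hG z₀
    (κ := δ / (|C| + 1)) (by positivity)
  rw [hz₀] at hres
  set ε₀ := min ε₁ (min ε₂ ε₃) with hε₀
  have hε₀0 : 0 < ε₀ := by positivity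
  have hI₁ : ∀ ε ∈ Ioc 0 ε₀, ε ∈ Ioc 0 ε₁ := fun ε hε => ⟨hε.1, hε.2.trans (min_le_left _ _)⟩
  have hI₂ : ∀ ε ∈ Ioc 0 ε₀, ε ∈ Ioc 0 ε₂ := fun ε hε =>
    ⟨hε.1, hε.2.trans ((min_le_right _ _).trans (min_le_left _ _))⟩
  have hI₃ : ∀ ε ∈ Ioc 0 ε₀, ε ∈ Ioc 0 ε₃ := fun ε hε =>
    ⟨hε.1, hε.2.trans ((min_le_right _ _).trans (min_le_right _ _))⟩
  choose! Z hZr hZ hZC hZu using fun ε (hε : ε ∈ Ioc 0 ε₀) => hsol ε (hI₁ ε hε)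
  have hdiff : ∀ ε ∈ Ioc 0 ε₀, supNorm ((fun x => (extend01 (Z ε) x).1) - u₀)
      ≤ |C| * ‖oscillatingMap (fluxProj n) hG ε z₀ - z₀‖ := by
    intro ε hε
    refine supNorm_le fun x hx => ?_
    rw [Pi.sub_apply, ← (hz₀u x hx).1]
    calc ‖(extend01 (Z ε) x).1 - (extend01 z₀ x).1‖
        ≤ ‖extend01 (Z ε) x - extend01 z₀ x‖ := norm_fst_le (extend01 (Z ε) x - extend01 z₀ x)
      _ ≤ ‖Z ε - z₀‖ := (Z ε - z₀).norm_coe_le_norm _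
      _ ≤ C * ‖oscillatingMap (fluxProj n) hG ε z₀ - z₀‖ := hZC ε hε
      _ ≤ _ := mul_le_mul_of_nonneg_right (le_abs_self C) (norm_nonneg _)
  have hCδ : ∀ κ > 0, |C| * (κ / (|C| + 1)) ≤ κ := fun κ hκ => by
    rw [mul_div_assoc', div_le_iff₀ (by positivity)]
    linarith
  refine ⟨ε₀, hε₀0, δ, hδ0, fun ε x => (extend01 (Z ε) x).1, fun ε hε => ⟨⟨?_, ?_⟩, ?_⟩, ?_, ?_⟩
  · refine (h.isFirstOrderForm_oscillating ε).isWeakSolution (hZ ε hε) fun x hx => ?_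
    calc ‖(extend01 (Z ε) x).1‖
        = ‖(extend01 (Z ε) x - extend01 z₀ x).1 + (extend01 z₀ x).1‖ := by simp
      _ ≤ r + ρ := (norm_add_le _ _).trans (add_le_add ((norm_fst_le _).trans
          (((Z ε - z₀).norm_coe_le_norm _).trans (hZr ε hε))) (hz₀ρ x))
      _ ≤ 1 := by linarith
  · exact (hdiff ε hε).trans ((mul_le_mul_of_nonneg_left (hres ε (hI₃ ε hε))
      (abs_nonneg _)).trans (hCδ δ hδ0))
  · intro w hw hwδ
    have hwu : ∀ x ∈ Icc (0 : ℝ) 1, ‖w x - u₀ x‖ ≤ δ := fun x hx =>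
      (norm_le_supNorm (u := w - u₀) (hw.1.continuousOn.sub hu₀c) hx).trans hwδ
    have hw1 : ∀ x ∈ Icc (0 : ℝ) 1, ‖w x‖ ≤ 1 := fun x hx => by
      calc ‖w x‖ = ‖(w x - u₀ x) + u₀ x‖ := by simp
        _ ≤ r + ρ := (norm_add_le _ _).trans
          (add_le_add ((hwu x hx).trans (min_le_right _ _)) (hu₀ρ x hx))
        _ ≤ 1 := by linarith
    obtain ⟨z, hzw, hz⟩ := (h.isFirstOrderForm_oscillating ε).exists_bvpSolve_eq hw hw1
    have hzu : ∀ x ∈ Icc (0 : ℝ) 1, ‖(extend01 z x).1 - (extend01 z₀ x).1‖ ≤ δ := fun x hx => by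
      rw [(hzw x hx).1, (hz₀u x hx).1]
      exact hwu x hx
    have hzq := hflux ε (hI₂ ε hε) z hz fun x hx => (hzu x hx).trans (min_le_left _ _)
    have hzr : ‖z - z₀‖ ≤ r := by
      refine (BoundedContinuousFunction.norm_le hr0.le).2 fun x => ?_
      rw [BoundedContinuousFunction.sub_apply, ← extend01_coe z, ← extend01_coe z₀]
      exact max_le ((hzu x x.2).trans (min_le_right _ _)) (hzq x x.2)
    intro x hx
    rw [← (hzw x hx).1, hZu ε hε z hzr hz]
  · rw [Metric.tendsto_nhdsWithin_nhds]
    intro κ hκ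
    obtain ⟨ε₄, hε₄, hres'⟩ := exists_oscillatingMap_sub_averagedMap_le (fluxProj n) hG z₀
      (κ := κ / 2 / (|C| + 1)) (by positivity)
    rw [hz₀] at hres'
    refine ⟨min ε₀ ε₄, by positivity, fun ε hε hd => ?_⟩
    have hε : 0 < ε := hε
    rw [Real.dist_eq, sub_zero, abs_of_pos hε] at hd
    rw [Real.dist_eq, sub_zero, abs_of_nonneg (supNorm_nonneg _)]
    have := (hdiff ε ⟨hε, hd.le.trans (min_le_left _ _)⟩).trans ((mul_le_mul_of_nonneg_left
      (hres' ε ⟨hε, hd.le.trans (min_le_right _ _)⟩) (abs_nonneg _)).trans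
      (hCδ (κ / 2) (by positivity)))
    exact this.trans_lt (by linarith)
  · rintro ⟨haX, hfX⟩
    have hcoef := hG.comp (continuous_extend01 z₀) (extend01_proj01 z₀)
    obtain ⟨K, hK0, hK⟩ := hcoef.exists_bound
    -- `z₀` solves the averaged system, whose field is bounded along it.
    have hlip : ∀ s ∈ Icc (0 : ℝ) 1, ∀ s' ∈ Icc (0 : ℝ) 1,
        ‖extend01 z₀ s - extend01 z₀ s'‖ ≤ K * |s - s'| := fun s hs s' hs' => by
      rw [bvpSolve_sub_eq_integral hz₀ hs' hs]
      exact norm_integral_le_of_bound01 (fun x _ => norm_cellMean_le (hK x)) hs' hs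
    obtain ⟨Λ, hΛ⟩ := h.exists_lipschitz_redField haX hfX
      (fun x => (hz₀ρ x).trans hu₀_lt.le) hlip
    obtain ⟨C', hC'⟩ := exists_oscillatingMap_sub_averagedMap_le_mul (fluxProj n) hG z₀ hΛ
    rw [hz₀] at hC'
    refine Asymptotics.IsBigO.of_bound (|C| * C') ?_
    filter_upwards [Ioc_mem_nhdsGT hε₀0] with ε hε
    rw [Real.norm_of_nonneg (supNorm_nonneg _), Real.norm_of_nonneg hε.1.le, mul_assoc]
    exact (hdiff ε hε).trans (mul_le_mul_of_nonneg_left (hC' ε hε.1) (abs_nonneg _))
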